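/- Let $V$ be a finite non-empty set and let $\mathcal L=(L(x,y))_{x,y\in V}$ be a Markov generator on $V$, i.e. $L(x,y)\ge 0$ for $x\neq y$ and $L(x,x)=-\sum_{y\ne x}L(x,y)$; put $L(x)=-L(x,x)$ and $\mathcal L[f](x)=\sum_{y\in V}L(x,y)f(y)$. Let $X=(X_t)_{t\ge0}$ be the associated continuous-time Markov chain: in a state $y$ it waits an exponential time of parameter $L(y)$ (forever if $L(y)=0$) and then, independently, jumps to $z\ne y$ with probability $L(y,z)/L(y)$. Write $\mathbb P_x,\mathbb E_x$ for its law and expectation when $X_0=x$, and $(\mathcal G_t)_{t\ge 0}$ for the completed right-continuous filtration generated by $X$. Let $\phi:V\to[0,\infty)$ and $r>0$. The value function and the stopping region are $$u(x)=\sup_{\tau}\mathbb E_x\big[e^{-r\tau}\phi(X_\tau)\big],\qquad D=\{x\in V: u(x)=\phi(x)\},$$ where the supremum is over all $(\mathcal G_t)$-stopping times $\tau$ with values in $[0,\infty]$, and $e^{-r\tau}\phi(X_\tau)=0$ on $\{\tau=\infty\}$. Define recursively $$D_1=\{x\in V:\mathcal L[\phi](x)-r\phi(x)\le 0\},\qquad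 D_{n+1}=\{x\in D_n:\mathcal L[u_n](x)-ru_n(x)\le 0\}\quad(n\ge1),$$ where, for $n\ge 1$, $$\tau_n=\inf\{t\ge0: X_t\in D_n\},\qquad u_n(x)=\mathbb E_x\big[e^{-r\tau_n}\phi(X_{\tau_n})\mathbf 1_{\tau_n<\infty}\big].$$ Then the problem is well posed (for every $x$, all the payoffs $e^{-r\tau}\phi(X_\tau)$ are $\mathbb P_x$-integrable with expectations bounded in $\tau$, and each $\tau_n$ is a stopping time), and: 1. $u_n(x)\le u_{n+1}(x)$ for all $n\ge 1$ and $x\in V$, and $\lim_{n\to\infty}u_n(x)=u(x)$ for all $x\in V$; 2. $\bigcap_{n\ge1}D_n=D$; 3. the procedure stops after at most $\mathrm{card}(V)$ steps: there is $n_0$ with $1\le n_0\le \mathrm{card}(V)$ such that $u_n=u$ and $D_n=D$ for all $n\ge n_0$. -/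

import Mathlib

open MeasureTheory ProbabilityTheory Filter Topology
open scoped NNReal ENNReal

noncomputable section

/-- A Markov generator on the finite set `V`: a real matrix with nonnegative off-diagonal entries
and diagonal entries `L(x,x) = -∑_{y ≠ x} L(x,y)`. -/
structure MarkovGenerator (V : Type*) [Fintype V] [DecidableEq V] where
  /-- The entries `L(x,y)`. -/
  rate : V → V → ℝ
  rate_nonneg : ∀ x y, x ≠ y → 0 ≤ rate x y
  rate_diag : ∀ x, rate x x = -∑ y ∈ Finset.univ.erase x, rate x y

/-- Sample points of the jump-and-hold construction: the coordinate `n + 1` is the pair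
`(σ_{n+1} - σ_n, X_{σ_{n+1}})` of the `n`-th holding time and the state sampled after it;
the coordinate `0` is `(0, X_0)`. -/
abbrev JumpPath (V : Type*) : Type _ := ℕ → ℝ≥0∞ × V

namespace JumpPath

variable {V : Type*}

/-- The embedded chain: the state `X_{σ_n}`. -/
def state (ω : JumpPath V) (n : ℕ) : V := (ω n).2

/-- The jump time `σ_n`. -/
def jumpTime (ω : JumpPath V) (n : ℕ) : ℝ≥0∞ := ∑ k ∈ Finset.range n, (ω (k + 1)).1

open Classical in
/-- The process `X_t`, with values in `V ⊔ {△}` (`none` is the cemetery point): it equals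
`X_{σ_n}` for `σ_n ≤ t < σ_{n+1}`, and `△` when `t` is at or beyond the explosion time. -/
def process (t : ℝ≥0) (ω : JumpPath V) : Option V :=
  if h : ∃ n, (t : ℝ≥0∞) < ω.jumpTime (n + 1) then some (ω.state (Nat.find h)) else none

variable [MeasurableSpace V]

lemma measurable_jumpTime (n : ℕ) : Measurable fun ω : JumpPath V => ω.jumpTime n := by
  unfold jumpTime
  fun_prop

lemma measurableSet_process [DiscreteMeasurableSpace V] (t : ℝ≥0) (A : Set (Option V)) :
    MeasurableSet (process t ⁻¹' A : Set (JumpPath V)) := by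
  classical
  have hlt : ∀ n, MeasurableSet {ω : JumpPath V | (t : ℝ≥0∞) < ω.jumpTime (n + 1)} := fun n =>
    measurableSet_lt measurable_const (measurable_jumpTime (n + 1))
  have hst : ∀ n, MeasurableSet {ω : JumpPath V | some (ω.state n) ∈ A} := fun n =>
    (measurable_snd.comp (measurable_pi_apply n) : Measurable fun ω : JumpPath V => (ω n).2)
      (MeasurableSet.of_discrete (s := {v : V | some v ∈ A}))
  have key : (process t ⁻¹' A : Set (JumpPath V)) =
      (⋃ n, {ω | (t : ℝ≥0∞) < ω.jumpTime (n + 1)} ∩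
        (⋂ m, ⋂ (_ : m < n), {ω : JumpPath V | (t : ℝ≥0∞) < ω.jumpTime (m + 1)}ᶜ) ∩
          {ω | some (ω.state n) ∈ A}) ∪
      ((⋃ n, {ω : JumpPath V | (t : ℝ≥0∞) < ω.jumpTime (n + 1)})ᶜ ∩ {_ω | none ∈ A}) := by
    ext ω
    by_cases h : ∃ n, (t : ℝ≥0∞) < ω.jumpTime (n + 1)
    · simp only [Set.mem_preimage, process, dif_pos h, Set.mem_union, Set.mem_iUnion,
        Set.mem_inter_iff, Set.mem_ofPred_eq, Set.mem_iInter, Set.mem_compl_iff]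
      constructor
      · intro hA
        exact Or.inl ⟨Nat.find h, ⟨Nat.find_spec h, fun m hm => Nat.find_min h hm⟩, hA⟩
      · rintro (⟨n, ⟨h1, h2⟩, h3⟩ | ⟨h1, -⟩)
        · rwa [(Nat.find_eq_iff h).2 ⟨h1, h2⟩]
        · exact absurd h h1
    · simp only [Set.mem_preimage, process, dif_neg h, Set.mem_union, Set.mem_iUnion,
        Set.mem_inter_iff, Set.mem_ofPred_eq, Set.mem_iInter, Set.mem_compl_iff]
      constructor
      · intro hA
        exact Or.inr ⟨h, hA⟩
      · rintro (⟨n, ⟨h1, -⟩, -⟩ | ⟨-, h2⟩)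
        · exact absurd ⟨n, h1⟩ h
        · exact h2
  rw [key]
  refine (MeasurableSet.iUnion fun n => ((hlt n).inter ?_).inter (hst n)).union
    ((MeasurableSet.iUnion hlt).compl.inter (MeasurableSet.const _))
  exact MeasurableSet.iInter fun m => MeasurableSet.iInter fun _ => (hlt m).compl

/-- The `P`-completion of the `σ`-algebra of the path space. -/
abbrev completedSpace (P : Measure (JumpPath V)) : MeasurableSpace (JumpPath V) :=
  inferInstanceAs (MeasurableSpace (NullMeasurableSpace (JumpPath V) P))

/-- The completed natural filtration of `X` under `P`: the `σ`-algebra at time `t` is generated by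
`X_s`, `s ≤ t`, and by all the `P`-null sets. -/
def completedFiltration [DiscreteMeasurableSpace V] (P : Measure (JumpPath V)) :
    Filtration ℝ≥0 (completedSpace P) where
  seq t := (⨆ s ≤ t, MeasurableSpace.comap (process s) ⊤) ⊔
    MeasurableSpace.generateFrom {N | P N = 0}
  mono' := fun _ _ hst => sup_le_sup
    (iSup₂_le fun u hu => le_iSup₂_of_le u (hu.trans hst) le_rfl) le_rfl
  le' := by
    refine fun t => sup_le (iSup₂_le fun s _ => ?_) (MeasurableSpace.generateFrom_le fun N hN => ?_)
    · rintro _ ⟨A, -, rfl⟩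
      exact (measurableSet_process s A).nullMeasurableSet (μ := P)
    · exact NullMeasurableSet.of_null hN

/-- The filtration `(𝒢_t)`: the completed right-continuous filtration generated by `X`. -/
def filtration [DiscreteMeasurableSpace V] (P : Measure (JumpPath V)) :
    Filtration ℝ≥0 (completedSpace P) :=
  (completedFiltration P).rightCont

/-- A random time is a stopping time under `P` if it is one for the filtration `(𝒢_t)`. -/
def IsStopping [DiscreteMeasurableSpace V] (P : Measure (JumpPath V))
    (τ : JumpPath V → WithTop ℝ≥0) : Prop :=
  IsStoppingTime (filtration P) τ

/-- The first hitting time `inf {t ≥ 0 : X_t ∈ D}` (`⊤` if `D` is never hit). -/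
def hitTime (D : Set V) : JumpPath V → WithTop ℝ≥0 :=
  hittingAfter (process : ℝ≥0 → JumpPath V → Option V) (some '' D) 0

/-- The discounted payoff `e^{-rτ} φ(X_τ)`, equal to `0` on `{τ = ∞}` (and at the cemetery). -/
def payoff (r : ℝ) (φ : V → ℝ) (τ : JumpPath V → WithTop ℝ≥0) (ω : JumpPath V) : ℝ :=
  if τ ω = ⊤ then 0
  else Real.exp (-r * ((τ ω).untopD 0 : ℝ≥0)) * (process ((τ ω).untopD 0) ω).elim 0 φ

end JumpPath

namespace MarkovGenerator

variable {V : Type*} [Fintype V] [DecidableEq V] (L : MarkovGenerator V)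

/-- The action `𝓛[f](x) = ∑_y L(x,y) f(y)`. -/
def apply (f : V → ℝ) (x : V) : ℝ := ∑ y, L.rate x y * f y

/-- The total jump rate `L(x) = -L(x,x)`. -/
def exitRate (x : V) : ℝ := -L.rate x x

lemma exitRate_eq (x : V) : L.exitRate x = ∑ y ∈ Finset.univ.erase x, L.rate x y := by
  rw [exitRate, L.rate_diag, neg_neg]

lemma exitRate_nonneg (x : V) : 0 ≤ L.exitRate x := by
  rw [exitRate_eq]
  exact Finset.sum_nonneg fun y hy => L.rate_nonneg x y (Finset.ne_of_mem_erase hy).symm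

/-- The law of a holding time at `x`: exponential of parameter `L(x)`, and a.s. `∞` if
`L(x) = 0`. -/
def holdLaw (x : V) : Measure ℝ≥0∞ :=
  if L.exitRate x = 0 then Measure.dirac ⊤
  else (expMeasure (L.exitRate x)).map ENNReal.ofReal

instance (x : V) : IsProbabilityMeasure (L.holdLaw x) := by
  unfold holdLaw
  split_ifs with h
  · infer_instance
  · have : IsProbabilityMeasure (expMeasure (L.exitRate x)) :=
      isProbabilityMeasure_expMeasure (lt_of_le_of_ne (L.exitRate_nonneg x) (Ne.symm h))
    exact Measure.isProbabilityMeasure_map (by fun_prop)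

variable [MeasurableSpace V]

/-- The law of the state sampled after leaving `x`: `y ≠ x` with probability `L(x,y) / L(x)`.
If `L(x) = 0`, then `x` is never left, and `x` itself is taken by convention. -/
def jumpLaw (x : V) : Measure V :=
  if L.exitRate x = 0 then Measure.dirac x
  else ∑ y ∈ Finset.univ.erase x,
    ENNReal.ofReal (L.rate x y / L.exitRate x) • Measure.dirac y

instance (x : V) : IsProbabilityMeasure (L.jumpLaw x) := by
  unfold jumpLaw
  split_ifs with h
  · infer_instance
  · constructor
    simp only [Measure.coe_finsetSum, Finset.sum_apply, Measure.smul_apply, measure_univ,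
      smul_eq_mul, mul_one]
    rw [← ENNReal.ofReal_sum_of_nonneg, ← Finset.sum_div, ← exitRate_eq, div_self h,
      ENNReal.ofReal_one]
    intro y hy
    exact div_nonneg (L.rate_nonneg x y (Finset.ne_of_mem_erase hy).symm) (L.exitRate_nonneg x)

variable [DiscreteMeasurableSpace V]

/-- From the state `x`, the holding time and the next state are sampled independently. -/
def stepKernel : Kernel V (ℝ≥0∞ × V) := Kernel.ofFunOfCountable fun x =>
  (L.holdLaw x).prod (L.jumpLaw x)

instance : IsMarkovKernel L.stepKernel :=
  ⟨fun x => (inferInstance : IsProbabilityMeasure ((L.holdLaw x).prod (L.jumpLaw x)))⟩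

/-- The law of step `n + 1` given the steps `0, …, n` depends on the current state only. -/
def historyKernel (n : ℕ) :
    Kernel ((i : Finset.Iic n) → (fun _ : ℕ => ℝ≥0∞ × V) i) (ℝ≥0∞ × V) :=
  L.stepKernel.comap (fun h => (h ⟨n, Finset.mem_Iic.2 le_rfl⟩).2) (by fun_prop)

instance (n : ℕ) : IsMarkovKernel (L.historyKernel n) := by
  unfold historyKernel
  infer_instance

/-- The probability `ℙ_x`: the law of the jump-and-hold construction started from `X_0 = x`. -/
def law (x : V) : Measure (JumpPath V) :=
  Kernel.trajMeasure (X := fun _ : ℕ => ℝ≥0∞ × V) (Measure.dirac (0, x)) L.historyKernel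

instance (x : V) : IsProbabilityMeasure (L.law x) := by
  unfold law
  infer_instance

/-- The expected payoff `𝔼_x[e^{-rτ} φ(X_τ)]`. -/
def reward (r : ℝ) (φ : V → ℝ) (τ : JumpPath V → WithTop ℝ≥0) (x : V) : ℝ :=
  ∫ ω, JumpPath.payoff r φ τ ω ∂(L.law x)

/-- The expected payoffs from `x` of all the stopping times. -/
def rewards (r : ℝ) (φ : V → ℝ) (x : V) : Set ℝ :=
  {c | ∃ τ, JumpPath.IsStopping (L.law x) τ ∧ c = L.reward r φ τ x}

/-- The value function `u(x) = sup_τ 𝔼_x[e^{-rτ} φ(X_τ)]`. -/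
def value (r : ℝ) (φ : V → ℝ) (x : V) : ℝ := sSup (L.rewards r φ x)

/-- The stopping region `D = {u = φ}`. -/
def stoppingRegion (r : ℝ) (φ : V → ℝ) : Set V := {x | L.value r φ x = φ x}

/-- The sets `D_n`, `n ≥ 1`, of the recursion:
`D_1 = {𝓛[φ] - rφ ≤ 0}` and `D_{n+1} = {x ∈ D_n : 𝓛[u_n](x) - r u_n(x) ≤ 0}`, where `u_n` is the
expected payoff of stopping at the first hitting time of `D_n`. The index `0` is not used. -/
def stopSet (r : ℝ) (φ : V → ℝ) : ℕ → Set V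
  | 0 => Set.univ
  | 1 => {x | L.apply φ x - r * φ x ≤ 0}
  | n + 2 => {x ∈ stopSet r φ (n + 1) |
      L.apply (L.reward r φ (JumpPath.hitTime (stopSet r φ (n + 1)))) x
        - r * L.reward r φ (JumpPath.hitTime (stopSet r φ (n + 1))) x ≤ 0}

/-- The functions `u_n(x) = 𝔼_x[e^{-rτ_n} φ(X_{τ_n}) 1_{τ_n < ∞}]`, `n ≥ 1`, where `τ_n` is the
first hitting time of `D_n`. -/
def stopValue (r : ℝ) (φ : V → ℝ) (n : ℕ) : V → ℝ :=
  L.reward r φ (JumpPath.hitTime (L.stopSet r φ n))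

end MarkovGenerator

end

/-!
Three facts about the chain carry the theorem; the rest is a discrete minimum principle.

* *Verification* (`MarkovGenerator.reward_le`): if `f ≥ φ` and `𝓛[f] ≤ r f` everywhere, then no
  stopping time has an expected payoff larger than `f`. The process `e^{-rt} f(X_t)` is a
  supermartingale: between two fixed instants `s ≤ t`, its expectation decreases from each of the
  instants `(σ_n ∨ s) ∧ t` to the next (`setLIntegral_stageGain_succ_le`). This only uses the law of
  one step of the jump chain, since an event of the past of `s` is determined, before the jump
  `n + 1`, by the first `n` steps. Fatou's lemma then gives the inequality from `s` to `t`; no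
  argument about explosion is needed, as the reward at the cemetery is `0`. A stopping time of the
  completed right-continuous filtration is approximated from the right on the grids `ℕ / (k + 1)`,
  and right-continuity of the paths with Fatou's lemma gives the conclusion
  (`lintegral_stoppedGain_le`).
* *Hitting times* (`MarkovGenerator.reward_hitTime_spec`): the expected payoff `w` of the first
  hitting time of `D` solves the Dirichlet problem `w = φ` on `D`, `𝓛[w] = r w` off `D`. The
  problem has a solution `g` by linear algebra; as `e^{-rσ_n} g(X_{σ_n})`, stopped when the jump
  chain enters `D`, has a constant expectation, and `𝔼[e^{-rσ_n}]` decays geometrically, `g = w`.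
* *Stopping* (`isStopping_hitTime`): hitting times are stopping times, by right-continuity.

The minimum principle then shows that, in passing from `D_n` to `D_{n+1}`, the function `u_n`
increases, strictly on `D_n \ D_{n+1}` (`reward_hitTime_improve`). Hence `u_n ≥ φ`, with strict
inequality off `D_n`. If `D_{n+1} = D_n`, then `𝓛[u_n] ≤ r u_n` everywhere, so `u_n` is the value
function by verification, and `D_n` is the stopping region. All the `D_n` contain the maximum points
of `φ`, so they are nonempty and become stationary after at most `card V` steps.
-/

noncomputable section

/-! ### Freezing a path after finitely many steps -/

namespace JumpPath

variable {V : Type*}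

/-- The path which follows `ω` up to the step `n` and then stays forever in the state `X_{σ_n}`. -/
def freeze (n : ℕ) (ω : JumpPath V) : JumpPath V :=
  fun k => if k ≤ n then ω k else (⊤, ω.state n)

lemma freeze_of_le {n k : ℕ} (h : k ≤ n) (ω : JumpPath V) : freeze n ω k = ω k := if_pos h

lemma freeze_freeze (n : ℕ) (ω : JumpPath V) : freeze n (freeze n ω) = freeze n ω := by
  funext k
  by_cases h : k ≤ n <;> simp [freeze, state, h]

lemma state_freeze {n k : ℕ} (h : k ≤ n) (ω : JumpPath V) : (freeze n ω).state k = ω.state k := by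
  rw [state, freeze_of_le h, state]

lemma jumpTime_freeze {n k : ℕ} (h : k ≤ n) (ω : JumpPath V) :
    (freeze n ω).jumpTime k = ω.jumpTime k := by
  refine Finset.sum_congr rfl fun i hi => ?_
  rw [freeze_of_le (by have := Finset.mem_range.1 hi; omega)]

lemma jumpTime_zero (ω : JumpPath V) : ω.jumpTime 0 = 0 := by simp [jumpTime]

lemma jumpTime_succ (ω : JumpPath V) (n : ℕ) :
    ω.jumpTime (n + 1) = ω.jumpTime n + (ω (n + 1)).1 := Finset.sum_range_succ _ _

lemma jumpTime_mono (ω : JumpPath V) : Monotone ω.jumpTime :=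
  monotone_nat_of_le_succ fun n => by rw [jumpTime_succ]; exact le_self_add

lemma jumpTime_succ_freeze (n : ℕ) (ω : JumpPath V) : (freeze n ω).jumpTime (n + 1) = ⊤ := by
  simp [jumpTime_succ, freeze]

variable [MeasurableSpace V]

lemma measurable_state (n : ℕ) : Measurable fun ω : JumpPath V => ω.state n :=
  measurable_snd.comp (measurable_pi_apply n)

lemma measurable_freeze (n : ℕ) : Measurable (freeze n : JumpPath V → JumpPath V) := by
  refine measurable_pi_iff.2 fun k => ?_
  by_cases h : k ≤ n
  · simpa [freeze, h] using measurable_pi_apply k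
  · simpa [freeze, h] using measurable_const.prodMk (measurable_state n)

end JumpPath

namespace MarkovGenerator

open JumpPath

variable {V : Type*} [Fintype V] [DecidableEq V] [MeasurableSpace V] [DiscreteMeasurableSpace V]
  (L : MarkovGenerator V)

/-- Conditionally on the first `n` steps, the step `n + 1` has the law `stepKernel (X_{σ_n})`. -/
lemma lintegral_succ (x : V) (n : ℕ) {G : JumpPath V → ℝ≥0∞ × V → ℝ≥0∞}
    (hG : Measurable (Function.uncurry G)) (hGn : ∀ ω y, G (freeze n ω) y = G ω y) :
    ∫⁻ ω, G ω (ω (n + 1)) ∂L.law x =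
      ∫⁻ ω, ∫⁻ y, G ω y ∂L.stepKernel (ω.state n) ∂L.law x := by
  let e : ((i : Finset.Iic n) → (fun _ : ℕ => ℝ≥0∞ × V) i) → JumpPath V := fun h k =>
    if hk : k ≤ n then h ⟨k, Finset.mem_Iic.2 hk⟩ else (⊤, (h ⟨n, Finset.mem_Iic.2 le_rfl⟩).2)
  have he : Measurable e := by
    refine measurable_pi_iff.2 fun k => ?_
    by_cases hk : k ≤ n
    · simp only [e, hk, dite_true]
      fun_prop
    · simp only [e, hk, dite_false]
      fun_prop
  have hef : ∀ ω : JumpPath V, e (Preorder.frestrictLe n ω) = freeze n ω := by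
    intro ω
    funext k
    by_cases hk : k ≤ n <;> simp [e, freeze, hk, Preorder.frestrictLe, state]
  have hres : Measurable fun ω : JumpPath V =>
      (Preorder.frestrictLe (π := fun _ : ℕ => ℝ≥0∞ × V) n ω) := by fun_prop
  have hG' : Measurable fun p : ((i : Finset.Iic n) → (fun _ : ℕ => ℝ≥0∞ × V) i) × (ℝ≥0∞ × V) =>
      G (e p.1) p.2 := hG.comp ((he.comp measurable_fst).prodMk measurable_snd)
  calc ∫⁻ ω, G ω (ω (n + 1)) ∂L.law x
      = ∫⁻ p, G (e p.1) p.2 ∂((L.law x).map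
          (fun ω : JumpPath V => (Preorder.frestrictLe (π := fun _ : ℕ => ℝ≥0∞ × V) n ω,
            ω (n + 1)))) := by
        rw [lintegral_map hG' (by fun_prop)]
        simp only [hef, hGn]
    _ = ∫⁻ h, ∫⁻ y, G (e h) y ∂L.historyKernel n h
          ∂((L.law x).map (Preorder.frestrictLe (π := fun _ : ℕ => ℝ≥0∞ × V) n)) := by
        rw [law, ← Kernel.map_frestrictLe_trajMeasure_compProd_eq_map_trajMeasure,
          Measure.lintegral_compProd hG']
    _ = ∫⁻ ω, ∫⁻ y, G ω y ∂L.stepKernel (ω.state n) ∂L.law x := by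
        rw [lintegral_map hG'.lintegral_kernel_prod_right' hres]
        simp only [hef, hGn]
        rfl

lemma law_zero (x : V) : ∀ᵐ ω ∂L.law x, ω 0 = (0, x) := by
  have hres : Measurable fun ω : JumpPath V =>
      (Preorder.frestrictLe (π := fun _ : ℕ => ℝ≥0∞ × V) 0 ω) := by fun_prop
  have h : (L.law x).map (Preorder.frestrictLe (π := fun _ : ℕ => ℝ≥0∞ × V) 0) =
      (Measure.dirac ((0 : ℝ≥0∞), x)).map (MeasurableEquiv.piUnique _).symm := by
    rw [law, Kernel.trajMeasure, Measure.map_comp _ _ hres, Kernel.traj_map_frestrictLe,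
      Kernel.partialTraj_self, Measure.id_comp]
  have h2 : (L.law x).map (fun ω => ω 0) = Measure.dirac ((0 : ℝ≥0∞), x) := by
    have h3 := congrArg (Measure.map fun h => h ⟨0, Finset.mem_Iic.2 le_rfl⟩) h
    rw [Measure.map_map (by fun_prop) hres, Measure.map_map (by fun_prop) (by fun_prop)] at h3
    exact h3.trans Measure.map_id
  have h4 : ∀ᵐ p ∂(L.law x).map (fun ω => ω 0), p = ((0 : ℝ≥0∞), x) := by
    rw [h2, ae_dirac_eq]
    rfl
  exact ae_of_ae_map (measurable_pi_apply 0).aemeasurable h4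

end MarkovGenerator

/-! ### Discounting -/

/-- The discount factor `e^{-rt}` as an extended nonnegative number; it is `0` at `t = ∞`. -/
def discount (r : ℝ) (t : ℝ≥0∞) : ℝ≥0∞ :=
  if t = ⊤ then 0 else ENNReal.ofReal (Real.exp (-r * t.toReal))

section discount

variable {r : ℝ}

@[simp] lemma discount_top : discount r ⊤ = 0 := if_pos rfl

lemma discount_of_ne_top {t : ℝ≥0∞} (ht : t ≠ ⊤) :
    discount r t = ENNReal.ofReal (Real.exp (-r * t.toReal)) := if_neg ht

lemma discount_coe (t : ℝ≥0) : discount r t = ENNReal.ofReal (Real.exp (-r * t)) :=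
  discount_of_ne_top ENNReal.coe_ne_top

@[simp] lemma discount_zero : discount r 0 = 1 := by simp [discount]

lemma discount_add (s t : ℝ≥0∞) : discount r (s + t) = discount r s * discount r t := by
  by_cases hs : s = ⊤
  · simp [hs]
  by_cases ht : t = ⊤
  · simp [ht]
  rw [discount_of_ne_top hs, discount_of_ne_top ht, discount_of_ne_top (by simp [hs, ht]),
    ENNReal.toReal_add hs ht, ← ENNReal.ofReal_mul (Real.exp_nonneg _), ← Real.exp_add, mul_add]

lemma discount_le_one (hr : 0 ≤ r) (t : ℝ≥0∞) : discount r t ≤ 1 := by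
  rw [discount]
  split_ifs
  · exact zero_le
  · exact ENNReal.ofReal_le_one.2 (Real.exp_le_one_iff.2 (by
      have := mul_nonneg hr (ENNReal.toReal_nonneg (a := t)); linarith))

lemma discount_anti (hr : 0 ≤ r) : Antitone (discount r) := by
  intro s t hst
  obtain ⟨u, rfl⟩ := exists_add_of_le hst
  rw [discount_add]
  exact mul_le_of_le_one_right' (discount_le_one hr u)

lemma measurable_discount : Measurable (discount r) :=
  Measurable.ite (measurableSet_singleton _) measurable_const (by fun_prop)

end discount

namespace MarkovGenerator

open JumpPath

/-! ### One step of the jump chain -/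

section holding

variable {V : Type*} [Fintype V] [DecidableEq V] (L : MarkovGenerator V)

lemma apply_add_exitRate_mul (g : V → ℝ) (x : V) :
    L.apply g x + L.exitRate x * g x = ∑ y ∈ Finset.univ.erase x, L.rate x y * g y := by
  rw [apply, ← Finset.add_sum_erase _ _ (Finset.mem_univ x), exitRate]
  ring

lemma expMeasure_Ioi {c : ℝ} (hc : 0 < c) (a : ℝ≥0) :
    expMeasure c (Set.Ioi (a : ℝ)) = ENNReal.ofReal (Real.exp (-c * a)) := by
  have := isProbabilityMeasure_expMeasure hc
  rw [← Set.compl_Iic, prob_compl_eq_one_sub measurableSet_Iic, ← ofReal_cdf, cdf_expMeasure_eq hc,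
    if_pos a.coe_nonneg, ← ENNReal.ofReal_one, ← ENNReal.ofReal_sub _ (by
      rw [sub_nonneg, Real.exp_le_one_iff]; have := mul_nonneg hc.le a.coe_nonneg; linarith)]
  simp

lemma map_expMeasure_Ioi {c : ℝ} (hc : 0 < c) (a : ℝ≥0) :
    (expMeasure c).map ENNReal.ofReal (Set.Ioi (a : ℝ≥0∞)) =
      ENNReal.ofReal (Real.exp (-c * a)) := by
  rw [Measure.map_apply ENNReal.measurable_ofReal measurableSet_Ioi, ← expMeasure_Ioi hc]
  congr 1
  ext y
  rw [Set.mem_preimage, Set.mem_Ioi, Set.mem_Ioi, ← ENNReal.ofReal_coe_nnreal,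
    ENNReal.ofReal_lt_ofReal_iff']
  exact ⟨fun h => h.1, fun h => ⟨h, a.2.trans_lt h⟩⟩

lemma holdLaw_Ioi (x : V) (a : ℝ≥0) :
    L.holdLaw x (Set.Ioi (a : ℝ≥0∞)) = ENNReal.ofReal (Real.exp (-L.exitRate x * a)) := by
  rw [holdLaw]
  split_ifs with h
  · simp [h]
  · exact map_expMeasure_Ioi (lt_of_le_of_ne (L.exitRate_nonneg x) (Ne.symm h)) a

lemma holdLaw_ae_pos (x : V) : ∀ᵐ t ∂L.holdLaw x, 0 < t := by
  have h := L.holdLaw_Ioi x 0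
  simp only [ENNReal.coe_zero, NNReal.coe_zero, mul_zero, Real.exp_zero, ENNReal.ofReal_one] at h
  exact (mem_ae_iff_prob_eq_one measurableSet_Ioi).2 h

/-- Discounting an exponential time of parameter `λ = L(x)` at rate `r` multiplies its law by
`λ / (λ + r)` and changes the parameter into `λ + r`. If `L(x) = 0`, both sides vanish: the holding
time is infinite. -/
lemma setLIntegral_discount_holdLaw {r : ℝ} (hr : 0 < r) (x : V) {E : Set ℝ≥0∞}
    (hE : MeasurableSet E) :
    ∫⁻ t in E, discount r t ∂L.holdLaw x =
      ENNReal.ofReal (L.exitRate x / (L.exitRate x + r)) *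
        (expMeasure (L.exitRate x + r)).map ENNReal.ofReal E := by
  rw [holdLaw]
  split_ifs with h
  · classical
    rw [setLIntegral_dirac]
    simp [h]
  have hl : 0 < L.exitRate x := lt_of_le_of_ne (L.exitRate_nonneg x) (Ne.symm h)
  set l := L.exitRate x
  have hE' : MeasurableSet (ENNReal.ofReal ⁻¹' E) := ENNReal.measurable_ofReal hE
  rw [setLIntegral_map hE measurable_discount ENNReal.measurable_ofReal,
    Measure.map_apply ENNReal.measurable_ofReal hE]
  have hexp : ∀ c : ℝ, expMeasure c = volume.withDensity (exponentialPDF c) := fun c => rfl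
  rw [hexp, hexp, setLIntegral_withDensity_eq_setLIntegral_mul _ (by
      unfold exponentialPDF; fun_prop) (g := fun t => discount r (ENNReal.ofReal t))
      (measurable_discount.comp ENNReal.measurable_ofReal) hE',
    withDensity_apply _ hE', ← lintegral_const_mul _ (by unfold exponentialPDF; fun_prop)]
  refine setLIntegral_congr_fun hE' fun t _ => ?_
  rcases lt_or_ge t 0 with ht | ht
  · simp [exponentialPDF_of_neg ht]
  · simp only [Pi.mul_apply]
    rw [discount_of_ne_top ENNReal.ofReal_ne_top, ENNReal.toReal_ofReal ht,
      exponentialPDF_of_nonneg ht, exponentialPDF_of_nonneg ht,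
      ← ENNReal.ofReal_mul (by positivity), ← ENNReal.ofReal_mul (by positivity)]
    congr 1
    rw [mul_assoc, ← Real.exp_add, ← mul_assoc, div_mul_cancel₀ _ (by positivity)]
    congr 2
    ring

end holding

section step

variable {V : Type*} [Fintype V] [DecidableEq V] [MeasurableSpace V] [DiscreteMeasurableSpace V]
  (L : MarkovGenerator V)

lemma lintegral_jumpLaw {r : ℝ} (hr : 0 < r) {g : V → ℝ} (hg : ∀ x, 0 ≤ g x) (x : V) :
    ENNReal.ofReal (L.exitRate x / (L.exitRate x + r)) *
        ∫⁻ y, ENNReal.ofReal (g y) ∂L.jumpLaw x =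
      ENNReal.ofReal ((L.apply g x + L.exitRate x * g x) / (L.exitRate x + r)) := by
  rw [apply_add_exitRate_mul, jumpLaw]
  split_ifs with h
  · have h0 : ∀ y ∈ Finset.univ.erase x, L.rate x y = 0 := by
      rw [exitRate_eq] at h
      exact (Finset.sum_eq_zero_iff_of_nonneg fun y hy =>
        L.rate_nonneg x y (Finset.ne_of_mem_erase hy).symm).1 h
    rw [Finset.sum_eq_zero fun y hy => by rw [h0 y hy, zero_mul], h]
    simp
  have hl : 0 < L.exitRate x := lt_of_le_of_ne (L.exitRate_nonneg x) (Ne.symm h)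
  have hnn : ∀ y ∈ Finset.univ.erase x, 0 ≤ L.rate x y := fun y hy =>
    L.rate_nonneg x y (Finset.ne_of_mem_erase hy).symm
  rw [lintegral_finsetSum_measure]
  simp only [lintegral_smul_measure, lintegral_dirac, smul_eq_mul]
  rw [Finset.sum_div, ENNReal.ofReal_sum_of_nonneg fun y hy =>
    div_nonneg (mul_nonneg (hnn y hy) (hg y)) (by positivity), Finset.mul_sum]
  refine Finset.sum_congr rfl fun y hy => ?_
  rw [← ENNReal.ofReal_mul (div_nonneg (hnn y hy) hl.le), ← ENNReal.ofReal_mul (by positivity)]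
  congr 1
  field_simp

lemma lintegral_step (x : V) {F : ℝ≥0∞ → ℝ≥0∞} (hF : Measurable F) (g : V → ℝ≥0∞) :
    ∫⁻ p, F p.1 * g p.2 ∂L.stepKernel x = (∫⁻ t, F t ∂L.holdLaw x) * ∫⁻ y, g y ∂L.jumpLaw x :=
  lintegral_prod_mul hF.aemeasurable (measurable_of_countable g).aemeasurable

lemma lintegral_step_indicator_discount {r : ℝ} (hr : 0 < r) {g : V → ℝ} (hg : ∀ x, 0 ≤ g x)
    (x : V) {E : Set ℝ≥0∞} (hE : MeasurableSet E) :
    ∫⁻ p, E.indicator (discount r) p.1 * ENNReal.ofReal (g p.2) ∂L.stepKernel x =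
      (expMeasure (L.exitRate x + r)).map ENNReal.ofReal E *
        ENNReal.ofReal ((L.apply g x + L.exitRate x * g x) / (L.exitRate x + r)) := by
  rw [L.lintegral_step x (measurable_discount.indicator hE)
    (fun y => ENNReal.ofReal (g y)), lintegral_indicator hE,
    L.setLIntegral_discount_holdLaw hr x hE, ← L.lintegral_jumpLaw hr hg]
  ring

/-- Where `𝓛[g] = r g`, the discounted value of `g` after one jump is `g` on average. -/
lemma lintegral_step_discount_eq {r : ℝ} (hr : 0 < r) {g : V → ℝ} (hg : ∀ x, 0 ≤ g x)
    {x : V} (hx : L.apply g x - r * g x = 0) :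
    ∫⁻ p, discount r p.1 * ENNReal.ofReal (g p.2) ∂L.stepKernel x = ENNReal.ofReal (g x) := by
  have hc : 0 < L.exitRate x + r := add_pos_of_nonneg_of_pos (L.exitRate_nonneg x) hr
  have := isProbabilityMeasure_expMeasure hc
  have hp : IsProbabilityMeasure ((expMeasure (L.exitRate x + r)).map ENNReal.ofReal) :=
    Measure.isProbabilityMeasure_map (by fun_prop)
  have h := L.lintegral_step_indicator_discount hr hg x MeasurableSet.univ
  simp only [Set.indicator_univ] at h
  rw [h, measure_univ, one_mul]
  congr 1
  field_simp
  linarith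

lemma lintegral_step_discount {r : ℝ} (hr : 0 < r) (x : V) :
    ∫⁻ p, discount r p.1 ∂L.stepKernel x =
      ENNReal.ofReal (L.exitRate x / (L.exitRate x + r)) := by
  have hc : 0 < L.exitRate x + r := add_pos_of_nonneg_of_pos (L.exitRate_nonneg x) hr
  have := isProbabilityMeasure_expMeasure hc
  have hp : IsProbabilityMeasure ((expMeasure (L.exitRate x + r)).map ENNReal.ofReal) :=
    Measure.isProbabilityMeasure_map (by fun_prop)
  have h1 := L.lintegral_step x (measurable_discount (r := r)) (fun _ => 1)
  have h2 := L.setLIntegral_discount_holdLaw hr x MeasurableSet.univ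
  simp only [mul_one, lintegral_const, measure_univ, Measure.restrict_univ] at h1 h2
  rw [h1, h2]

/-- If `𝓛[g] ≤ r g` at `x`, then from the instant `a` spent in `x` to the instant `b`, or to the
next jump if it comes before, the discounted value of `g` decreases on average. -/
lemma lintegral_step_le {r : ℝ} (hr : 0 < r) {g : V → ℝ} (hg : ∀ x, 0 ≤ g x)
    {x : V} (hx : L.apply g x - r * g x ≤ 0) {a b : ℝ≥0} (hab : a ≤ b) :
    ∫⁻ p, (Set.Ioc (a : ℝ≥0∞) b).indicator (discount r) p.1 * ENNReal.ofReal (g p.2)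
        ∂L.stepKernel x + discount r b * ENNReal.ofReal (g x) * L.holdLaw x (Set.Ioi b) ≤
      discount r a * ENNReal.ofReal (g x) * L.holdLaw x (Set.Ioi a) := by
  have hc : 0 < L.exitRate x + r := add_pos_of_nonneg_of_pos (L.exitRate_nonneg x) hr
  -- `e^{-rt} ℙ(S > t) = ν(t, ∞)` for the holding time `S` at `x`, so that the three terms are
  -- masses of intervals for the same measure
  set ν := (expMeasure (L.exitRate x + r)).map ENNReal.ofReal with hν
  have key : ∀ t : ℝ≥0, discount r t * ENNReal.ofReal (g x) * L.holdLaw x (Set.Ioi t) =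
      ν (Set.Ioi t) * ENNReal.ofReal (g x) := by
    intro t
    rw [hν, map_expMeasure_Ioi hc, holdLaw_Ioi, discount_coe, mul_right_comm,
      ← ENNReal.ofReal_mul (Real.exp_nonneg _), ← Real.exp_add]
    congr 4
    ring
  have hle : ENNReal.ofReal ((L.apply g x + L.exitRate x * g x) / (L.exitRate x + r)) ≤
      ENNReal.ofReal (g x) := by
    refine ENNReal.ofReal_le_ofReal ?_
    rw [div_le_iff₀ hc]
    linarith
  rw [key, key, L.lintegral_step_indicator_discount hr hg x measurableSet_Ioc, ← hν]
  calc _ ≤ ν (Set.Ioc a b) * ENNReal.ofReal (g x) + ν (Set.Ioi b) * ENNReal.ofReal (g x) := by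
        gcongr
    _ = ν (Set.Ioi a) * ENNReal.ofReal (g x) := by
        rw [← add_mul, ← measure_union (Set.Ioc_disjoint_Ioi le_rfl) measurableSet_Ioi,
          Set.Ioc_union_Ioi_eq_Ioi (by exact_mod_cast hab)]

end step

end MarkovGenerator

/-! ### The process and its rewards along a path -/

namespace JumpPath

variable {V : Type*}

lemma process_eq_of_mem {ω : JumpPath V} {n : ℕ} {t : ℝ≥0} (h1 : ω.jumpTime n ≤ t)
    (h2 : (t : ℝ≥0∞) < ω.jumpTime (n + 1)) : process t ω = some (ω.state n) := by
  classical
  have h : ∃ n, (t : ℝ≥0∞) < ω.jumpTime (n + 1) := ⟨n, h2⟩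
  rw [process, dif_pos h]
  congr 2
  exact (Nat.find_eq_iff h).2 ⟨h2, fun m hm => not_lt.2 ((ω.jumpTime_mono hm).trans h1)⟩

lemma exists_of_process_eq_some {ω : JumpPath V} {t : ℝ≥0} {v : V} (h : process t ω = some v) :
    ∃ n, ω.jumpTime n ≤ t ∧ (t : ℝ≥0∞) < ω.jumpTime (n + 1) ∧ ω.state n = v := by
  classical
  rw [process] at h
  split_ifs at h with h'
  refine ⟨Nat.find h', ?_, Nat.find_spec h', Option.some_injective _ h⟩
  rcases Nat.eq_zero_or_pos (Nat.find h') with h0 | h0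
  · rw [h0, jumpTime_zero]
    exact zero_le
  · obtain ⟨m, hm⟩ := Nat.exists_eq_succ_of_ne_zero h0.ne'
    have := Nat.find_min h' (m := m) (by omega)
    rw [hm]
    exact not_lt.1 this

lemma process_eq_none_iff {ω : JumpPath V} {t : ℝ≥0} :
    process t ω = none ↔ ∀ n, ω.jumpTime n ≤ t := by
  constructor
  · intro h n
    rw [process] at h
    split_ifs at h with h'
    exact (ω.jumpTime_mono (Nat.le_succ n)).trans (not_lt.1 fun hn => h' ⟨n, hn⟩)
  · intro h
    rw [process, dif_neg]
    rintro ⟨n, hn⟩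
    exact not_lt.2 (h _) hn

/-- The paths are right-continuous and locally constant to the right, explosion included. -/
lemma eventually_process_eq (t : ℝ≥0) (ω : JumpPath V) :
    ∀ᶠ u in 𝓝[≥] t, process u ω = process t ω := by
  cases h : process t ω with
  | none =>
    filter_upwards [self_mem_nhdsWithin] with u hu
    exact process_eq_none_iff.2 fun n =>
      (process_eq_none_iff.1 h n).trans (ENNReal.coe_le_coe.2 hu)
  | some v =>
    obtain ⟨n, h1, h2, rfl⟩ := exists_of_process_eq_some h
    have : ∀ᶠ u : ℝ≥0 in 𝓝 t, (u : ℝ≥0∞) < ω.jumpTime (n + 1) :=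
      ENNReal.continuous_coe.continuousAt.eventually_lt continuousAt_const h2
    filter_upwards [self_mem_nhdsWithin, nhdsWithin_le_nhds this] with u hu hu2
    exact process_eq_of_mem (h1.trans (ENNReal.coe_le_coe.2 hu)) hu2

lemma process_freeze {ω : JumpPath V} {n : ℕ} {t : ℝ≥0}
    (h : (t : ℝ≥0∞) < ω.jumpTime (n + 1)) : process t (freeze n ω) = process t ω := by
  cases hp : process t ω with
  | none => exact absurd (process_eq_none_iff.1 hp (n + 1)) (not_le.2 h)
  | some v =>
    obtain ⟨m, h1, h2, rfl⟩ := exists_of_process_eq_some hp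
    have hmn : m ≤ n := by
      by_contra! hm
      exact not_le.2 h ((ω.jumpTime_mono hm).trans h1)
    rw [← state_freeze hmn]
    refine process_eq_of_mem ((jumpTime_freeze hmn ω).trans_le h1) ?_
    rcases hmn.eq_or_lt with rfl | hlt
    · rw [jumpTime_succ_freeze]
      exact ENNReal.coe_lt_top
    · rwa [jumpTime_freeze hlt]

/-- An event of the raw filtration at time `s` depends on the path on `[0, s]` only. -/
lemma mem_iff_of_process_eq {s : ℝ≥0} {A : Set (JumpPath V)}
    (hA : MeasurableSet[⨆ u ≤ s, MeasurableSpace.comap (process u) ⊤] A) {ω ω' : JumpPath V}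
    (h : ∀ u ≤ s, process u ω = process u ω') : ω ∈ A ↔ ω' ∈ A := by
  let Φ : JumpPath V → Set.Iic s → Option V := fun ω u => process u ω
  have hle : (⨆ u ≤ s, MeasurableSpace.comap (process (V := V) u) ⊤) ≤
      MeasurableSpace.comap Φ ⊤ := by
    refine iSup₂_le fun u hu => ?_
    rintro _ ⟨B, -, rfl⟩
    exact ⟨{p | p ⟨u, hu⟩ ∈ B}, trivial, rfl⟩
  obtain ⟨B, -, rfl⟩ := hle A hA
  have : Φ ω = Φ ω' := funext fun u => h u u.2
  rw [Set.mem_preimage, Set.mem_preimage, this]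

/-- The discounted reward `e^{-rt} f(X_t)` as an extended nonnegative number, with `f(△) = 0`. -/
def gain (r : ℝ) (f : V → ℝ) (t : ℝ≥0) (ω : JumpPath V) : ℝ≥0∞ :=
  discount r t * (process t ω).elim 0 fun v => ENNReal.ofReal (f v)

/-- The discounted reward `e^{-rτ} f(X_τ)` as an extended nonnegative number. -/
def stoppedGain (r : ℝ) (f : V → ℝ) (τ : JumpPath V → WithTop ℝ≥0) (ω : JumpPath V) : ℝ≥0∞ :=
  if τ ω = ⊤ then 0 else gain r f ((τ ω).untopD 0) ω

lemma payoff_nonneg {r : ℝ} {f : V → ℝ} (hf : ∀ x, 0 ≤ f x) (τ : JumpPath V → WithTop ℝ≥0)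
    (ω : JumpPath V) : 0 ≤ payoff r f τ ω := by
  rw [payoff]
  split_ifs
  · exact le_rfl
  · refine mul_nonneg (Real.exp_nonneg _) ?_
    cases process ((τ ω).untopD 0) ω with
    | none => exact le_rfl
    | some v => exact hf v

lemma ofReal_payoff {r : ℝ} {f : V → ℝ} (τ : JumpPath V → WithTop ℝ≥0) (ω : JumpPath V) :
    ENNReal.ofReal (payoff r f τ ω) = stoppedGain r f τ ω := by
  rw [payoff, stoppedGain]
  split_ifs
  · simp
  · rw [gain, discount_coe, ENNReal.ofReal_mul (Real.exp_nonneg _)]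
    cases process ((τ ω).untopD 0) ω <;> simp

lemma payoff_mono {r : ℝ} {f g : V → ℝ} (hfg : ∀ x, f x ≤ g x) (τ : JumpPath V → WithTop ℝ≥0)
    (ω : JumpPath V) : payoff r f τ ω ≤ payoff r g τ ω := by
  rw [payoff, payoff]
  split_ifs
  · exact le_rfl
  · refine mul_le_mul_of_nonneg_left ?_ (Real.exp_nonneg _)
    cases process ((τ ω).untopD 0) ω with
    | none => exact le_rfl
    | some v => exact hfg v

lemma payoff_const_le {r : ℝ} (hr : 0 ≤ r) {C : ℝ} (hC : 0 ≤ C) (τ : JumpPath V → WithTop ℝ≥0)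
    (ω : JumpPath V) : payoff r (fun _ => C) τ ω ≤ C := by
  rw [payoff]
  split_ifs
  · exact hC
  · have h1 : Real.exp (-r * ((τ ω).untopD 0 : ℝ≥0)) ≤ 1 := Real.exp_le_one_iff.2 (by
      have := mul_nonneg hr ((τ ω).untopD 0).coe_nonneg
      linarith)
    cases process ((τ ω).untopD 0) ω with
    | none => simpa using hC
    | some v => exact mul_le_of_le_one_left hC h1

lemma gain_of_mem {r : ℝ} {f : V → ℝ} {ω : JumpPath V} {n : ℕ} {t : ℝ≥0}
    (h1 : ω.jumpTime n ≤ t) (h2 : (t : ℝ≥0∞) < ω.jumpTime (n + 1)) :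
    gain r f t ω = discount r t * ENNReal.ofReal (f (ω.state n)) := by
  rw [gain, process_eq_of_mem h1 h2]
  rfl

lemma tendsto_gain {r : ℝ} {f : V → ℝ} {ω : JumpPath V} {t : ℝ≥0} {u : ℕ → ℝ≥0}
    (hu : Tendsto u atTop (𝓝[≥] t)) :
    Tendsto (fun k => gain r f (u k) ω) atTop (𝓝 (gain r f t ω)) := by
  have hd : Tendsto (fun k => discount r (u k)) atTop (𝓝 (discount r t)) := by
    simp only [discount_coe]
    have hc : Continuous fun v : ℝ≥0 => ENNReal.ofReal (Real.exp (-r * v)) :=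
      ENNReal.continuous_ofReal.comp (by fun_prop)
    exact (hc.tendsto t).comp (hu.mono_right nhdsWithin_le_nhds)
  have hne : ∀ o : Option V, (o.elim 0 fun v => ENNReal.ofReal (f v)) ≠ ⊤ := by
    rintro (_ | v) <;> simp
  refine (ENNReal.Tendsto.mul_const (b := (process t ω).elim 0 fun v => ENNReal.ofReal (f v)) hd
    (Or.inr (hne _))).congr' ?_
  filter_upwards [hu.eventually (eventually_process_eq t ω)] with k hk
  rw [gain, hk]

variable [MeasurableSpace V] [DiscreteMeasurableSpace V]

lemma measurable_gain (r : ℝ) (f : V → ℝ) (t : ℝ≥0) : Measurable (gain r f t) := by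
  refine Measurable.const_mul ?_ _
  exact fun S _ => measurableSet_process t ((fun o : Option V =>
    o.elim 0 fun v => ENNReal.ofReal (f v)) ⁻¹' S)

end JumpPath

/-! ### The supermartingale property at fixed times -/

namespace JumpPath

variable {V : Type*}

/-- The discounted reward at the instant `(σ_n ∨ s) ∧ t`. -/
def stageGain (r : ℝ) (f : V → ℝ) (s t : ℝ≥0) (n : ℕ) (ω : JumpPath V) : ℝ≥0∞ :=
  if ω.jumpTime n ≤ s then gain r f s ω
  else if ω.jumpTime n ≤ t then discount r (ω.jumpTime n) * ENNReal.ofReal (f (ω.state n))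
  else gain r f t ω

/-- Before the explosion, `t < σ_n` for large `n`, and the reward at `(σ_n ∨ s) ∧ t` is the one at
`t`; after the explosion, the reward at `t` is `0`. -/
lemma gain_le_liminf_stageGain (r : ℝ) (f : V → ℝ) {s t : ℝ≥0} (hst : s ≤ t) (ω : JumpPath V) :
    gain r f t ω ≤ liminf (fun n => stageGain r f s t n ω) atTop := by
  cases h : process t ω with
  | none => simp [gain, h]
  | some v =>
    obtain ⟨n, -, h2, -⟩ := exists_of_process_eq_some h
    refine le_liminf_of_le (by isBoundedDefault) ?_
    filter_upwards [eventually_ge_atTop (n + 1)] with m hm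
    have hm2 : (t : ℝ≥0∞) < ω.jumpTime m := h2.trans_le (ω.jumpTime_mono hm)
    rw [stageGain, if_neg (not_le.2 ((ENNReal.coe_le_coe.2 hst).trans_lt hm2)),
      if_neg (not_le.2 hm2)]

variable [MeasurableSpace V] [DiscreteMeasurableSpace V]

lemma measurable_discount_mul_state (r : ℝ) (f : V → ℝ) (n : ℕ) :
    Measurable fun ω : JumpPath V =>
      discount r (ω.jumpTime n) * ENNReal.ofReal (f (ω.state n)) :=
  (measurable_discount.comp (measurable_jumpTime n)).mul
    ((Measurable.of_discrete (f := fun v => ENNReal.ofReal (f v))).comp (measurable_state n))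

lemma measurable_stageGain (r : ℝ) (f : V → ℝ) (s t : ℝ≥0) (n : ℕ) :
    Measurable (stageGain r f s t n : JumpPath V → ℝ≥0∞) :=
  Measurable.ite (measurableSet_le (measurable_jumpTime n) measurable_const)
    (measurable_gain r f s)
    (Measurable.ite (measurableSet_le (measurable_jumpTime n) measurable_const)
      (measurable_discount_mul_state r f n) (measurable_gain r f t))

end JumpPath

namespace MarkovGenerator

open JumpPath

variable {V : Type*} [Fintype V] [DecidableEq V] [MeasurableSpace V] [DiscreteMeasurableSpace V]
  (L : MarkovGenerator V)

lemma stepKernel_ae_pos (x : V) : ∀ᵐ p ∂L.stepKernel x, 0 < p.1 := by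
  have h : (L.stepKernel x).map Prod.fst = L.holdLaw x := by
    change ((L.holdLaw x).prod (L.jumpLaw x)).map Prod.fst = _
    rw [Measure.map_fst_prod, measure_univ, one_smul]
  exact ae_of_ae_map measurable_fst.aemeasurable (h ▸ L.holdLaw_ae_pos x)

lemma law_ae_pos (x : V) : ∀ᵐ ω ∂L.law x, ∀ n, 0 < (ω (n + 1)).1 := by
  refine ae_all_iff.2 fun n => ?_
  have hS : MeasurableSet {p : ℝ≥0∞ × V | p.1 = 0} := measurable_fst (measurableSet_singleton 0)
  have hm : Measurable ({p : ℝ≥0∞ × V | p.1 = 0}.indicator (1 : ℝ≥0∞ × V → ℝ≥0∞)) :=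
    measurable_one.indicator hS
  have h := L.lintegral_succ x n
    (G := fun _ p => {p : ℝ≥0∞ × V | p.1 = 0}.indicator (1 : ℝ≥0∞ × V → ℝ≥0∞) p)
    (hm.comp measurable_snd) (fun _ _ => rfl)
  have h0 : ∀ y, ∫⁻ p, {p : ℝ≥0∞ × V | p.1 = 0}.indicator (1 : ℝ≥0∞ × V → ℝ≥0∞) p
      ∂L.stepKernel y = 0 := by
    intro y
    rw [lintegral_indicator_one hS]
    refine measure_mono_null (fun p hp => ?_) (L.stepKernel_ae_pos y)
    exact fun hpos : 0 < p.1 => hpos.ne' hp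
  simp only [h0, lintegral_zero] at h
  have h2 := (lintegral_eq_zero_iff (hm.comp (measurable_pi_apply (n + 1)))).1 h
  filter_upwards [h2] with ω hω
  rw [pos_iff_ne_zero]
  intro hz
  simp [Set.indicator, hz] at hω

/-- The one-step inequality behind the supermartingale property: when the chain has arrived in `z`
at the time `c`, its discounted reward decreases on average from the instant `c ∨ s` to the instant
`t`, or to the next jump if it comes before. -/
lemma lintegral_stage_step_le {r : ℝ} (hr : 0 < r) {f : V → ℝ} (hf : ∀ x, 0 ≤ f x) {z : V}
    (hz : L.apply f z - r * f z ≤ 0) {s t c : ℝ≥0} (hst : s ≤ t) (hct : c ≤ t) :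
    ∫⁻ p, (if (s : ℝ≥0∞) < c + p.1 then
        (if c + p.1 ≤ t then discount r (c + p.1) * ENNReal.ofReal (f p.2)
          else discount r t * ENNReal.ofReal (f z)) else 0) ∂L.stepKernel z ≤
      ∫⁻ p, (if (s : ℝ≥0∞) < c + p.1 then
        discount r (max s c : ℝ≥0) * ENNReal.ofReal (f z) else 0) ∂L.stepKernel z := by
  -- `a` and `b` count the time from the arrival in `z`; if `s < c`, the subtraction gives `a = 0`,
  -- and `s < c + p.1` amounts to `a < p.1` because holding times are positive
  set a : ℝ≥0 := s - c with ha
  set b : ℝ≥0 := t - c with hb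
  have hab : a ≤ b := tsub_le_tsub_right hst c
  have hcb : c + b = t := add_tsub_cancel_of_le hct
  have hca : c + a = max s c := by
    rcases le_total s c with h | h
    · rw [ha, tsub_eq_zero_of_le h, add_zero, max_eq_right h]
    · rw [ha, add_tsub_cancel_of_le h, max_eq_left h]
  have hlt : ∀ p : ℝ≥0∞, 0 < p → ((s : ℝ≥0∞) < c + p ↔ (a : ℝ≥0∞) < p) := by
    intro p hp
    rcases lt_or_ge s c with h | h
    · rw [ha, tsub_eq_zero_of_le h.le]
      simp only [ENNReal.coe_zero, hp, iff_true]
      exact (ENNReal.coe_lt_coe.2 h).trans_le le_self_add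
    · rw [← add_tsub_cancel_of_le h, ENNReal.coe_add, ← ha,
        ENNReal.add_lt_add_iff_left ENNReal.coe_ne_top]
  have hle : ∀ p : ℝ≥0∞, (c + p ≤ t ↔ p ≤ (b : ℝ≥0∞)) := by
    intro p
    rw [← hcb, ENNReal.coe_add, ENNReal.add_le_add_iff_left ENNReal.coe_ne_top]
  have hI : ∀ d : ℝ≥0, Measurable ((Set.Ioi (d : ℝ≥0∞)).indicator (1 : ℝ≥0∞ → ℝ≥0∞)) := fun d =>
    measurable_one.indicator measurableSet_Ioi
  have hhold : ∀ d : ℝ≥0, ∫⁻ p, (Set.Ioi (d : ℝ≥0∞)).indicator 1 p.1 ∂L.stepKernel z =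
      L.holdLaw z (Set.Ioi (d : ℝ≥0∞)) := by
    intro d
    have := L.lintegral_step z (hI d) (fun _ => 1)
    simpa only [mul_one, lintegral_one, measure_univ,
      lintegral_indicator_one measurableSet_Ioi] using this
  have hI1 : ∀ d : ℝ≥0, Measurable fun p : ℝ≥0∞ × V =>
      (Set.Ioi (d : ℝ≥0∞)).indicator (1 : ℝ≥0∞ → ℝ≥0∞) p.1 := fun d => (hI d).comp measurable_fst
  have hm1 : Measurable fun p : ℝ≥0∞ × V =>
      (Set.Ioc (a : ℝ≥0∞) b).indicator (discount r) p.1 * ENNReal.ofReal (f p.2) :=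
    ((measurable_discount.indicator measurableSet_Ioc).comp measurable_fst).mul
      ((Measurable.of_discrete (f := fun v => ENNReal.ofReal (f v))).comp measurable_snd)
  calc _ = ∫⁻ p, discount r c * ((Set.Ioc (a : ℝ≥0∞) b).indicator (discount r) p.1 *
          ENNReal.ofReal (f p.2) + discount r b * ENNReal.ofReal (f z) *
            (Set.Ioi (b : ℝ≥0∞)).indicator 1 p.1) ∂L.stepKernel z := by
        refine lintegral_congr_ae ?_
        filter_upwards [L.stepKernel_ae_pos z] with p hp
        simp only [hlt p.1 hp, hle, Set.indicator, Set.mem_Ioc, Set.mem_Ioi, Pi.one_apply]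
        rw [← hcb, ENNReal.coe_add, discount_add, discount_add]
        by_cases h1 : (a : ℝ≥0∞) < p.1
        · by_cases h2 : p.1 ≤ b
          · simp [h1, h2, not_lt.2 h2, mul_assoc]
          · simp [h1, h2, mul_assoc, not_le.1 h2]
        · have h2 : ¬ (b : ℝ≥0∞) < p.1 := fun h => h1 ((ENNReal.coe_le_coe.2 hab).trans_lt h)
          simp [h1, h2]
    _ = discount r c * (∫⁻ p, (Set.Ioc (a : ℝ≥0∞) b).indicator (discount r) p.1 *
          ENNReal.ofReal (f p.2) ∂L.stepKernel z + discount r b * ENNReal.ofReal (f z) *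
            L.holdLaw z (Set.Ioi (b : ℝ≥0∞))) := by
        rw [lintegral_const_mul _ (by exact hm1.add ((hI1 b).const_mul _)),
          lintegral_add_left hm1, lintegral_const_mul _ (hI1 b), hhold]
    _ ≤ discount r c * (discount r a * ENNReal.ofReal (f z) *
          L.holdLaw z (Set.Ioi (a : ℝ≥0∞))) := by
        gcongr
        exact L.lintegral_step_le hr hf hz hab
    _ = ∫⁻ p, discount r c * (discount r a * ENNReal.ofReal (f z)) *
          (Set.Ioi (a : ℝ≥0∞)).indicator 1 p.1 ∂L.stepKernel z := by
        rw [lintegral_const_mul _ (hI1 a), hhold]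
        ring
    _ = _ := by
        refine lintegral_congr_ae ?_
        filter_upwards [L.stepKernel_ae_pos z] with p hp
        simp only [hlt p.1 hp, Set.indicator, Set.mem_Ioi, Pi.one_apply]
        rw [← hca, ENNReal.coe_add, discount_add]
        split_ifs <;> simp [mul_assoc]

/-- The reward at `(σ_n ∨ s) ∧ t` decreases on average, on an event `A` of the past of `s`. All that
is used of `A` is that its trace on `{s < σ_{n+1}}` is determined by the first `n` steps. -/
lemma setLIntegral_stageGain_succ_le {r : ℝ} (hr : 0 < r) {f : V → ℝ} (hf : ∀ x, 0 ≤ f x)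
    (hLf : ∀ x, L.apply f x - r * f x ≤ 0) (x : V) {s t : ℝ≥0} (hst : s ≤ t) (n : ℕ)
    {A : Set (JumpPath V)} (hA : MeasurableSet A)
    (hAn : ∀ ω : JumpPath V, (s : ℝ≥0∞) < ω.jumpTime (n + 1) → (freeze n ω ∈ A ↔ ω ∈ A)) :
    ∫⁻ ω in A, stageGain r f s t (n + 1) ω ∂L.law x ≤
      ∫⁻ ω in A, stageGain r f s t n ω ∂L.law x := by
  classical
  have hst' : (s : ℝ≥0∞) ≤ t := ENNReal.coe_le_coe.2 hst
  -- off `R`, the instants `(σ_n ∨ s) ∧ t` and `(σ_{n+1} ∨ s) ∧ t` coincide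
  set R : Set (JumpPath V) := {ω | (s : ℝ≥0∞) < ω.jumpTime (n + 1)} ∩ {ω | ω.jumpTime n ≤ t}
    with hR
  have hRm : MeasurableSet R :=
    (measurableSet_lt measurable_const (measurable_jumpTime _)).inter
      (measurableSet_le (measurable_jumpTime _) measurable_const)
  rw [← lintegral_inter_add_sdiff _ A hRm, ← lintegral_inter_add_sdiff (stageGain r f s t n) A hRm]
  refine add_le_add ?_ (le_of_eq ?_)
  · -- on `A ∩ R`, the two rewards as functions of the first `n` steps and of the step `n + 1`
    let G1 : JumpPath V → ℝ≥0∞ × V → ℝ≥0∞ := fun ω p =>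
      if freeze n ω ∈ A ∧ ω.jumpTime n ≤ t then
        (if (s : ℝ≥0∞) < ω.jumpTime n + p.1 then
          (if ω.jumpTime n + p.1 ≤ t then
            discount r (ω.jumpTime n + p.1) * ENNReal.ofReal (f p.2)
          else discount r t * ENNReal.ofReal (f (ω.state n))) else 0) else 0
    let G2 : JumpPath V → ℝ≥0∞ × V → ℝ≥0∞ := fun ω p =>
      if freeze n ω ∈ A ∧ ω.jumpTime n ≤ t then
        (if (s : ℝ≥0∞) < ω.jumpTime n + p.1 then
          discount r (max s (ω.jumpTime n)) * ENNReal.ofReal (f (ω.state n)) else 0) else 0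
    have hσ : Measurable fun q : JumpPath V × (ℝ≥0∞ × V) => q.1.jumpTime n :=
      (measurable_jumpTime n).comp measurable_fst
    have hσp : Measurable fun q : JumpPath V × (ℝ≥0∞ × V) => q.1.jumpTime n + q.2.1 :=
      hσ.add (measurable_fst.comp measurable_snd)
    have hfm : Measurable fun v : V => ENNReal.ofReal (f v) := Measurable.of_discrete
    have hfz : Measurable fun q : JumpPath V × (ℝ≥0∞ × V) => ENNReal.ofReal (f (q.1.state n)) :=
      hfm.comp ((measurable_state n).comp measurable_fst)
    have hfp : Measurable fun q : JumpPath V × (ℝ≥0∞ × V) => ENNReal.ofReal (f q.2.2) :=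
      hfm.comp (measurable_snd.comp measurable_snd)
    have hset : MeasurableSet {q : JumpPath V × (ℝ≥0∞ × V) |
        freeze n q.1 ∈ A ∧ q.1.jumpTime n ≤ t} :=
      (((measurable_freeze n).comp measurable_fst) hA).inter
        (measurableSet_le hσ measurable_const)
    have hset2 : MeasurableSet {q : JumpPath V × (ℝ≥0∞ × V) |
        (s : ℝ≥0∞) < q.1.jumpTime n + q.2.1} := measurableSet_lt measurable_const hσp
    have hG1 : Measurable (Function.uncurry G1) :=
      Measurable.ite hset (Measurable.ite hset2 (Measurable.ite
        (measurableSet_le hσp measurable_const) ((measurable_discount.comp hσp).mul hfp)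
          (hfz.const_mul _)) measurable_const) measurable_const
    have hG2 : Measurable (Function.uncurry G2) :=
      Measurable.ite hset (Measurable.ite hset2 ((measurable_discount.comp
        (measurable_const.max hσ)).mul hfz) measurable_const) measurable_const
    have hmem : ∀ ω : JumpPath V, ω ∈ A ∩ R ↔
        (freeze n ω ∈ A ∧ ω.jumpTime n ≤ t) ∧ (s : ℝ≥0∞) < ω.jumpTime n + (ω (n + 1)).1 := by
      intro ω
      rw [← jumpTime_succ]
      constructor
      · rintro ⟨h1, h2, h3⟩
        exact ⟨⟨(hAn ω h2).2 h1, h3⟩, h2⟩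
      · rintro ⟨⟨h1, h3⟩, h2⟩
        exact ⟨(hAn ω h2).1 h1, h2, h3⟩
    have e1 : ∫⁻ ω in A ∩ R, stageGain r f s t (n + 1) ω ∂L.law x =
        ∫⁻ ω, G1 ω (ω (n + 1)) ∂L.law x := by
      rw [← lintegral_indicator (hA.inter hRm)]
      refine lintegral_congr fun ω => ?_
      by_cases hω : ω ∈ A ∩ R
      · have h := (hmem ω).1 hω
        rw [Set.indicator_of_mem hω]
        simp only [G1]
        rw [if_pos h.1, if_pos h.2, stageGain, if_neg (not_le.2 hω.2.1), jumpTime_succ]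
        split_ifs with h3
        · rfl
        · exact gain_of_mem h.1.2 (by rw [jumpTime_succ]; exact not_le.1 h3)
      · rw [Set.indicator_of_notMem hω]
        rw [hmem] at hω
        simp only [G1]
        split_ifs with h1 h2 <;> first | rfl | exact absurd ⟨h1, h2⟩ hω
    have e2 : ∫⁻ ω in A ∩ R, stageGain r f s t n ω ∂L.law x =
        ∫⁻ ω, G2 ω (ω (n + 1)) ∂L.law x := by
      rw [← lintegral_indicator (hA.inter hRm)]
      refine lintegral_congr fun ω => ?_
      by_cases hω : ω ∈ A ∩ R
      · have h := (hmem ω).1 hω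
        rw [Set.indicator_of_mem hω]
        simp only [G2]
        rw [if_pos h.1, if_pos h.2, stageGain]
        split_ifs with h3 h4
        · rw [max_eq_left h3]
          exact gain_of_mem h3 hω.2.1
        · rw [max_eq_right (not_le.1 h3).le]
        · exact absurd h.1.2 h4
      · rw [Set.indicator_of_notMem hω]
        rw [hmem] at hω
        simp only [G2]
        split_ifs with h1 h2 <;> first | rfl | exact absurd ⟨h1, h2⟩ hω
    rw [e1, e2, L.lintegral_succ x n hG1 (fun ω p => by
        simp only [G1, freeze_freeze, jumpTime_freeze le_rfl, state_freeze le_rfl]),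
      L.lintegral_succ x n hG2 (fun ω p => by
        simp only [G2, freeze_freeze, jumpTime_freeze le_rfl, state_freeze le_rfl])]
    refine lintegral_mono fun ω => ?_
    simp only [G1, G2]
    by_cases h : freeze n ω ∈ A ∧ ω.jumpTime n ≤ t
    · simp only [if_pos h]
      lift ω.jumpTime n to ℝ≥0 using ne_top_of_le_ne_top ENNReal.coe_ne_top h.2 with c hc
      have := L.lintegral_stage_step_le hr hf (hLf (ω.state n)) hst
        (ENNReal.coe_le_coe.1 h.2)
      simpa only [ENNReal.coe_max] using this
    · simp only [if_neg h]
      exact le_rfl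
  · refine setLIntegral_congr_fun (hA.diff hRm) fun ω hω => ?_
    simp only [stageGain]
    have hmono := ω.jumpTime_mono (Nat.le_succ n)
    by_cases h1 : ω.jumpTime (n + 1) ≤ s
    · rw [if_pos h1, if_pos (hmono.trans h1)]
    · have h2 : ¬ ω.jumpTime n ≤ t := fun h2 => hω.2 ⟨not_le.1 h1, h2⟩
      rw [if_neg h1, if_neg fun h => h2 (hmono.trans h), if_neg fun h => h2 (h.trans hst'),
        if_neg h2]

/-- The supermartingale property of `e^{-rt} f(X_t)` when `𝓛[f] ≤ r f`, for the raw filtration. -/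
lemma setLIntegral_gain_le_of_measurableSet {r : ℝ} (hr : 0 < r) {f : V → ℝ} (hf : ∀ x, 0 ≤ f x)
    (hLf : ∀ x, L.apply f x - r * f x ≤ 0) (x : V) {s t : ℝ≥0} (hst : s ≤ t)
    {A : Set (JumpPath V)}
    (hA : MeasurableSet[⨆ u ≤ s, MeasurableSpace.comap (process u) ⊤] A) :
    ∫⁻ ω in A, gain r f t ω ∂L.law x ≤ ∫⁻ ω in A, gain r f s ω ∂L.law x := by
  have hAm : MeasurableSet A := by
    refine (iSup₂_le fun u _ => ?_ : (⨆ u ≤ s, MeasurableSpace.comap (process u) ⊤) ≤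
      (inferInstance : MeasurableSpace (JumpPath V))) A hA
    rintro _ ⟨B, -, rfl⟩
    exact measurableSet_process u B
  have hstage : ∀ n, ∫⁻ ω in A, stageGain r f s t n ω ∂L.law x ≤
      ∫⁻ ω in A, gain r f s ω ∂L.law x := by
    intro n
    induction n with
    | zero =>
      refine le_of_eq (lintegral_congr fun ω => ?_)
      rw [stageGain, jumpTime_zero, if_pos zero_le]
    | succ n ih =>
      refine (L.setLIntegral_stageGain_succ_le hr hf hLf x hst n hAm fun ω hω => ?_).trans ih
      exact mem_iff_of_process_eq hA fun u hu =>
        process_freeze ((ENNReal.coe_le_coe.2 hu).trans_lt hω)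
  calc ∫⁻ ω in A, gain r f t ω ∂L.law x
      ≤ ∫⁻ ω in A, liminf (fun n => stageGain r f s t n ω) atTop ∂L.law x :=
        lintegral_mono fun ω => gain_le_liminf_stageGain r f hst ω
    _ ≤ liminf (fun n => ∫⁻ ω in A, stageGain r f s t n ω ∂L.law x) atTop :=
        lintegral_liminf_le fun n => measurable_stageGain r f s t n
    _ ≤ ∫⁻ ω in A, gain r f s ω ∂L.law x :=
        liminf_le_of_frequently_le' (Frequently.of_forall hstage)

end MarkovGenerator

/-! ### Approximation of random times on a grid -/

namespace JumpPath

variable {V : Type*} {τ : JumpPath V → WithTop ℝ≥0}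

/-- The reward of stopping at the first instant of the grid `(k+1)⁻¹ ℕ` which is later than `τ`. -/
def gridGain (r : ℝ) (f : V → ℝ) (τ : JumpPath V → WithTop ℝ≥0) (k : ℕ) (ω : JumpPath V) :
    ℝ≥0∞ :=
  ∑' i : ℕ, ({ω | τ ω < ((i + 1 : ℕ) * (k + 1 : ℝ≥0)⁻¹ : ℝ≥0)} \
    {ω | τ ω < (i * (k + 1 : ℝ≥0)⁻¹ : ℝ≥0)}).indicator
      (gain r f ((i + 1 : ℕ) * (k + 1 : ℝ≥0)⁻¹)) ω

lemma gridGain_of_top (r : ℝ) (f : V → ℝ) (k : ℕ) {ω : JumpPath V} (h : τ ω = ⊤) :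
    gridGain r f τ k ω = 0 := by
  simp [gridGain, Set.indicator, h]

lemma gridGain_of_eq (r : ℝ) (f : V → ℝ) (k : ℕ) {ω : JumpPath V} {T : ℝ≥0} (h : τ ω = T) :
    gridGain r f τ k ω = gain r f ((⌊T * (k + 1)⌋₊ + 1 : ℕ) * (k + 1 : ℝ≥0)⁻¹) ω := by
  have hk : (0 : ℝ≥0) < k + 1 := by positivity
  have hmem : ∀ i : ℕ, τ ω < (i * (k + 1 : ℝ≥0)⁻¹ : ℝ≥0) ↔ ⌊T * (k + 1)⌋₊ < i := by
    intro i
    rw [h, WithTop.coe_lt_coe, ← div_eq_mul_inv, lt_div_iff₀ hk, Nat.floor_lt zero_le]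
  rw [gridGain, tsum_eq_single ⌊T * (k + 1)⌋₊]
  · refine Set.indicator_of_mem ?_ _
    exact ⟨(hmem _).2 (Nat.lt_succ_self _), fun h' => lt_irrefl _ ((hmem _).1 h')⟩
  · intro i hi
    refine Set.indicator_of_notMem ?_ _
    rintro ⟨h1, h2⟩
    have h1' := (hmem _).1 h1
    have h2' := mt (hmem _).2 h2
    omega

lemma tendsto_gridGain (r : ℝ) (f : V → ℝ) (τ : JumpPath V → WithTop ℝ≥0) (ω : JumpPath V) :
    Tendsto (fun k => gridGain r f τ k ω) atTop (𝓝 (stoppedGain r f τ ω)) := by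
  by_cases h : τ ω = ⊤
  · simp [stoppedGain, h, gridGain_of_top]
  lift τ ω to ℝ≥0 using h with T hT
  simp only [stoppedGain, ← hT, gridGain_of_eq r f _ hT.symm]
  rw [if_neg WithTop.coe_ne_top, WithTop.untopD_coe]
  refine tendsto_gain ?_
  have hk : ∀ k : ℕ, (0 : ℝ≥0) < k + 1 := fun k => by positivity
  have h1 : ∀ k : ℕ, T ≤ (⌊T * (k + 1)⌋₊ + 1 : ℕ) * (k + 1 : ℝ≥0)⁻¹ := fun k => by
    rw [← div_eq_mul_inv, le_div_iff₀ (hk k)]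
    push_cast
    exact (Nat.lt_floor_add_one (T * ((k : ℝ≥0) + 1))).le
  have h2 : ∀ k : ℕ, (⌊T * (k + 1)⌋₊ + 1 : ℕ) * (k + 1 : ℝ≥0)⁻¹ ≤ T + (k + 1 : ℝ≥0)⁻¹ := fun k => by
    rw [← div_eq_mul_inv, div_le_iff₀ (hk k), add_mul, inv_mul_cancel₀ (hk k).ne']
    push_cast
    gcongr
    exact Nat.floor_le zero_le
  have h3 : Tendsto (fun k : ℕ => T + (k + 1 : ℝ≥0)⁻¹) atTop (𝓝 T) := by
    have : Tendsto (fun k : ℕ => (k + 1 : ℝ≥0)⁻¹) atTop (𝓝 0) := by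
      refine tendsto_inv_atTop_zero.comp ?_
      exact tendsto_atTop_mono (fun k => le_self_add) (tendsto_natCast_atTop_atTop (R := ℝ≥0))
    simpa using this.const_add T
  exact tendsto_nhdsWithin_iff.2 ⟨tendsto_of_tendsto_of_tendsto_of_le_of_le tendsto_const_nhds h3
    h1 h2, Eventually.of_forall h1⟩

end JumpPath

/-! ### The filtration and its stopping times -/

namespace JumpPath

variable {V : Type*} [MeasurableSpace V] [DiscreteMeasurableSpace V] {P : Measure (JumpPath V)}

/-- An event of the completed filtration is almost surely equal to an event of the raw one. -/
lemma exists_ae_eq_of_measurableSet_completedFiltration {s : ℝ≥0} {A : Set (JumpPath V)}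
    (hA : MeasurableSet[completedFiltration P s] A) :
    ∃ B, MeasurableSet[⨆ u ≤ s, MeasurableSpace.comap (process (V := V) u) ⊤] B ∧
      A =ᵐ[P] B := by
  have hle : completedFiltration P s ≤ eventuallyMeasurableSpace
      (⨆ u ≤ s, MeasurableSpace.comap (process (V := V) u) ⊤) (ae P) := by
    refine sup_le (@le_eventuallyMeasurableSpace _ _ (ae P) _)
      (MeasurableSpace.generateFrom_le fun N hN => ?_)
    exact ⟨∅, @MeasurableSet.empty _ (_), ae_eq_empty.2 hN⟩
  exact hle A hA

lemma nullMeasurableSet_of_completedFiltration {s : ℝ≥0} {A : Set (JumpPath V)}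
    (hA : MeasurableSet[completedFiltration P s] A) : NullMeasurableSet A P :=
  (completedFiltration P).le s A hA

lemma filtration_apply (t : ℝ≥0) :
    filtration P t = ⨅ u > t, completedFiltration P u := by
  rw [filtration]
  exact Filtration.rightCont_eq _ _

lemma IsStopping.measurableSet_lt {τ : JumpPath V → WithTop ℝ≥0} (hτ : IsStopping P τ) (t : ℝ≥0) :
    MeasurableSet[completedFiltration P t] {ω | τ ω < t} := by
  have h : {ω | τ ω < t} = ⋃ q : ℚ, ⋃ _ : 0 ≤ q ∧ (Real.toNNReal q : ℝ≥0) < t,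
      {ω | τ ω ≤ (Real.toNNReal q : ℝ≥0)} := by
    ext ω
    simp only [Set.mem_iUnion, Set.mem_ofPred_eq, exists_prop]
    constructor
    · intro hω
      lift τ ω to ℝ≥0 using hω.ne_top with T
      have hT : (T : ℝ) < t := by exact_mod_cast hω
      obtain ⟨q, h1, h2⟩ := exists_rat_btwn hT
      have hq : (0 : ℝ) ≤ q := T.coe_nonneg.trans h1.le
      refine ⟨q, ⟨by exact_mod_cast hq, ?_⟩, ?_⟩
      · rw [← NNReal.coe_lt_coe, Real.coe_toNNReal _ hq]
        exact h2
      · refine WithTop.coe_le_coe.2 ?_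
        rw [← NNReal.coe_le_coe, Real.coe_toNNReal _ hq]
        exact h1.le
    · rintro ⟨q, ⟨-, h1⟩, h2⟩
      exact h2.trans_lt (WithTop.coe_lt_coe.2 h1)
  rw [h]
  refine MeasurableSet.iUnion fun q => MeasurableSet.iUnion fun hq => ?_
  have h2 := hτ (Real.toNNReal q)
  rw [filtration_apply] at h2
  exact (iInf₂_le t hq.2 : _ ≤ completedFiltration P t) _ h2

/-- A random time `τ` is a stopping time for `(𝒢_t)` as soon as the events `{τ < t}` belong to the
completed filtration, because `{τ ≤ t}` is the intersection of the `{τ < u}`, `u > t`. -/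
lemma isStopping_of_measurableSet_lt {τ : JumpPath V → WithTop ℝ≥0}
    (h : ∀ t : ℝ≥0, MeasurableSet[completedFiltration P t] {ω | τ ω < t}) : IsStopping P τ := by
  intro t
  rw [filtration_apply]
  simp only [MeasurableSpace.measurableSet_iInf]
  intro u hu
  obtain ⟨v, -, hv, hlim⟩ := exists_seq_strictAnti_tendsto' (show t < u from hu)
  have heq : {ω | τ ω ≤ t} = ⋂ n, {ω | τ ω < v n} := by
    ext ω
    simp only [Set.mem_iInter, Set.mem_ofPred_eq]
    constructor
    · exact fun hω n => hω.trans_lt (WithTop.coe_lt_coe.2 (hv n).1)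
    · intro hω
      lift τ ω to ℝ≥0 using (hω 0).ne_top with T
      exact WithTop.coe_le_coe.2 (ge_of_tendsto' hlim fun n => (WithTop.coe_lt_coe.1 (hω n)).le)
  rw [heq]
  exact MeasurableSet.iInter fun n =>
    (completedFiltration P).mono (hv n).2.le _ (h (v n))

lemma isStopping_hitTime (D : Set V) : IsStopping P (hitTime D) := by
  refine isStopping_of_measurableSet_lt fun t => ?_
  have h : {ω : JumpPath V | hitTime D ω < t} = ⋃ q : ℚ, ⋃ _ : (Real.toNNReal q : ℝ≥0) < t,
      process (Real.toNNReal q) ⁻¹' (some '' D) := by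
    ext ω
    simp only [Set.mem_iUnion, Set.mem_ofPred_eq, exists_prop, Set.mem_preimage]
    rw [hitTime, hittingAfter_lt_iff]
    constructor
    · rintro ⟨u, ⟨-, hu⟩, huD⟩
      -- by right-continuity, the process is still in `D` at some rational time after `u`
      obtain ⟨w, hw, hsub⟩ := (mem_nhdsGE_iff_exists_Ico_subset' hu).1
        (eventually_process_eq u ω)
      have hlt : (u : ℝ) < min w t := by exact_mod_cast lt_min hw hu
      obtain ⟨q, h1, h2⟩ := exists_rat_btwn hlt
      have hq : (0 : ℝ) ≤ q := u.coe_nonneg.trans h1.le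
      have h1' : u ≤ Real.toNNReal q := by
        rw [← NNReal.coe_le_coe, Real.coe_toNNReal _ hq]
        exact h1.le
      have h2' : Real.toNNReal q < min w t := by
        rw [← NNReal.coe_lt_coe, Real.coe_toNNReal _ hq]
        exact_mod_cast h2
      refine ⟨q, h2'.trans_le (min_le_right _ _), ?_⟩
      have := hsub ⟨h1', h2'.trans_le (min_le_left _ _)⟩
      rw [Set.mem_ofPred_eq] at this
      rwa [this]
    · rintro ⟨q, h1, h2⟩
      exact ⟨_, ⟨zero_le, h1⟩, h2⟩
  rw [h]
  refine MeasurableSet.iUnion fun q => MeasurableSet.iUnion fun hq => ?_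
  exact (le_sup_left : _ ≤ completedFiltration P t) _
    ((le_iSup₂_of_le (Real.toNNReal q) hq.le le_rfl : MeasurableSpace.comap _ ⊤ ≤ _) _
      ⟨_, trivial, rfl⟩)

end JumpPath

/-! ### Optional stopping -/

namespace MarkovGenerator

open JumpPath

variable {V : Type*} [Fintype V] [DecidableEq V] [MeasurableSpace V] [DiscreteMeasurableSpace V]
  (L : MarkovGenerator V)

/-- The supermartingale property of `e^{-rt} f(X_t)` when `𝓛[f] ≤ r f`, for the completed
filtration. -/
lemma setLIntegral_gain_le {r : ℝ} (hr : 0 < r) {f : V → ℝ} (hf : ∀ x, 0 ≤ f x)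
    (hLf : ∀ x, L.apply f x - r * f x ≤ 0) (x : V) {s t : ℝ≥0} (hst : s ≤ t)
    {A : Set (JumpPath V)} (hA : MeasurableSet[completedFiltration (L.law x) s] A) :
    ∫⁻ ω in A, gain r f t ω ∂L.law x ≤ ∫⁻ ω in A, gain r f s ω ∂L.law x := by
  obtain ⟨B, hB, hAB⟩ := exists_ae_eq_of_measurableSet_completedFiltration hA
  rw [setLIntegral_congr hAB, setLIntegral_congr hAB]
  exact L.setLIntegral_gain_le_of_measurableSet hr hf hLf x hst hB

lemma law_ae_process_zero (x : V) : ∀ᵐ ω ∂L.law x, process 0 ω = some x := by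
  filter_upwards [L.law_zero x, L.law_ae_pos x] with ω h0 hpos
  have hs : ω.state 0 = x := by rw [state, h0]
  rw [← hs]
  refine process_eq_of_mem (by simp [jumpTime_zero]) ?_
  rw [jumpTime_succ, jumpTime_zero, zero_add]
  exact hpos 0

/-- Optional stopping on the grid `δ ℕ`, where the events `C j` stand for `{τ < jδ}`. -/
lemma sum_setLIntegral_gain_le {r : ℝ} (hr : 0 < r) {f : V → ℝ} (hf : ∀ x, 0 ≤ f x)
    (hLf : ∀ x, L.apply f x - r * f x ≤ 0) (x : V) (δ : ℝ≥0) {C : ℕ → Set (JumpPath V)}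
    (hC : ∀ j : ℕ, MeasurableSet[completedFiltration (L.law x) (j * δ)] (C j))
    (hCm : Monotone C) (j : ℕ) :
    ∑ i ∈ Finset.range j, ∫⁻ ω in C (i + 1) \ C i, gain r f ((i + 1 : ℕ) * δ) ω ∂L.law x +
      ∫⁻ ω in (C j)ᶜ, gain r f (j * δ) ω ∂L.law x ≤ ENNReal.ofReal (f x) := by
  have hn : ∀ j, NullMeasurableSet (C j) (L.law x) := fun j =>
    nullMeasurableSet_of_completedFiltration (hC j)
  induction j with
  | zero =>
    rw [Finset.sum_range_zero, zero_add]
    refine (setLIntegral_le_lintegral _ _).trans_eq ?_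
    calc ∫⁻ ω, gain r f ((0 : ℕ) * δ) ω ∂L.law x = ∫⁻ _, ENNReal.ofReal (f x) ∂L.law x := by
          refine lintegral_congr_ae ?_
          filter_upwards [L.law_ae_process_zero x] with ω hω
          simp [gain, hω]
      _ = ENNReal.ofReal (f x) := by simp
  | succ j ih =>
    refine le_trans ?_ ih
    rw [Finset.sum_range_succ, add_assoc]
    gcongr
    have hsplit : (C j)ᶜ = (C (j + 1) \ C j) ∪ (C (j + 1))ᶜ := by
      ext ω
      have : ω ∈ C j → ω ∈ C (j + 1) := fun h => hCm (Nat.le_succ j) h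
      simp only [Set.mem_compl_iff, Set.mem_union, Set.mem_sdiff]
      tauto
    have hdisj : Disjoint (C (j + 1) \ C j) (C (j + 1))ᶜ :=
      Set.disjoint_left.2 fun ω h1 h2 => h2 h1.1
    rw [← lintegral_add_measure, ← Measure.restrict_union₀ hdisj.aedisjoint (hn (j + 1)).compl,
      ← hsplit]
    refine L.setLIntegral_gain_le hr hf hLf x ?_ (hC j).compl
    gcongr
    exact_mod_cast Nat.le_succ j

section stopped

variable {x : V} {τ : JumpPath V → WithTop ℝ≥0}

lemma aemeasurable_indicator_gain (hτ : IsStopping (L.law x) τ) (r : ℝ) (f : V → ℝ) (k i : ℕ) :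
    AEMeasurable (({ω | τ ω < ((i + 1 : ℕ) * (k + 1 : ℝ≥0)⁻¹ : ℝ≥0)} \
      {ω | τ ω < (i * (k + 1 : ℝ≥0)⁻¹ : ℝ≥0)}).indicator
        (gain r f ((i + 1 : ℕ) * (k + 1 : ℝ≥0)⁻¹))) (L.law x) := by
  refine (measurable_gain _ _ _).aemeasurable.indicator₀ ?_
  exact (nullMeasurableSet_of_completedFiltration (hτ.measurableSet_lt _)).diff
    (nullMeasurableSet_of_completedFiltration (hτ.measurableSet_lt _))

lemma aemeasurable_gridGain (hτ : IsStopping (L.law x) τ) (r : ℝ) (f : V → ℝ) (k : ℕ) :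
    AEMeasurable (gridGain r f τ k) (L.law x) :=
  AEMeasurable.tsum fun i => L.aemeasurable_indicator_gain hτ r f k i

lemma aemeasurable_stoppedGain (hτ : IsStopping (L.law x) τ) (r : ℝ) (f : V → ℝ) :
    AEMeasurable (stoppedGain r f τ) (L.law x) :=
  aemeasurable_of_tendsto_metrizable_ae atTop (L.aemeasurable_gridGain hτ r f)
    (ae_of_all _ (tendsto_gridGain r f τ))

/-- A function `f ≥ 0` with `𝓛[f] ≤ r f` dominates the expected reward `𝔼_x[e^{-rτ} f(X_τ)]` of
every stopping time. -/
lemma lintegral_stoppedGain_le (hτ : IsStopping (L.law x) τ) {r : ℝ} (hr : 0 < r) {f : V → ℝ}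
    (hf : ∀ x, 0 ≤ f x)
    (hLf : ∀ x, L.apply f x - r * f x ≤ 0) :
    ∫⁻ ω, stoppedGain r f τ ω ∂L.law x ≤ ENNReal.ofReal (f x) := by
  have hgrid : ∀ k, ∫⁻ ω, gridGain r f τ k ω ∂L.law x ≤ ENNReal.ofReal (f x) := by
    intro k
    unfold gridGain
    rw [lintegral_tsum fun i => L.aemeasurable_indicator_gain hτ r f k i]
    refine ENNReal.tsum_le_of_sum_range_le fun j => ?_
    have h := L.sum_setLIntegral_gain_le hr hf hLf x (k + 1 : ℝ≥0)⁻¹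
      (C := fun j => {ω | τ ω < (j * (k + 1 : ℝ≥0)⁻¹ : ℝ≥0)})
      (fun j => hτ.measurableSet_lt _) (fun i j hij ω (hω : τ ω < _) => lt_of_lt_of_le hω
        (WithTop.coe_le_coe.2 (mul_le_mul_left (Nat.cast_le.2 hij) _))) j
    refine le_trans (le_of_eq ?_) (le_self_add.trans h)
    refine Finset.sum_congr rfl fun i _ => lintegral_indicator₀ ?_ _
    exact (nullMeasurableSet_of_completedFiltration (hτ.measurableSet_lt _)).diff
      (nullMeasurableSet_of_completedFiltration (hτ.measurableSet_lt _))
  calc ∫⁻ ω, stoppedGain r f τ ω ∂L.law x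
      = ∫⁻ ω, liminf (fun k => gridGain r f τ k ω) atTop ∂L.law x :=
        lintegral_congr fun ω => ((tendsto_gridGain r f τ ω).liminf_eq).symm
    _ ≤ liminf (fun k => ∫⁻ ω, gridGain r f τ k ω ∂L.law x) atTop :=
        lintegral_liminf_le' (L.aemeasurable_gridGain hτ r f)
    _ ≤ ENNReal.ofReal (f x) := liminf_le_of_frequently_le' (Frequently.of_forall hgrid)

end stopped

end MarkovGenerator

/-! ### The expected reward of a hitting time -/

namespace JumpPath

variable {V : Type*}

lemma jumpTime_le_hitTime {D : Set V} {ω : JumpPath V} {n : ℕ} (hn : ∀ k < n, ω.state k ∉ D)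
    {T : ℝ≥0} (hT : hitTime D ω = T) : ω.jumpTime n ≤ T := by
  by_contra! hlt
  obtain ⟨v, hTv, hv⟩ : ∃ v : ℝ≥0, T < v ∧ (v : ℝ≥0∞) ≤ ω.jumpTime n := by
    obtain ⟨v, h1, h2⟩ := ENNReal.lt_iff_exists_nnreal_btwn.1 hlt
    exact ⟨v, ENNReal.coe_lt_coe.1 h1, h2.le⟩
  have h : hitTime D ω < v := by
    rw [hT]
    exact WithTop.coe_lt_coe.2 hTv
  rw [hitTime, hittingAfter_lt_iff] at h
  obtain ⟨u, ⟨-, huv⟩, y, hy, hyu⟩ := h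
  obtain ⟨m, h1, -, rfl⟩ := exists_of_process_eq_some hyu.symm
  refine hn m ?_ hy
  by_contra! hnm
  exact absurd (h1.trans_lt (ENNReal.coe_lt_coe.2 huv))
    (not_lt.2 (hv.trans (ω.jumpTime_mono hnm)))

lemma stoppedGain_hitTime_of_mem (r : ℝ) (f : V → ℝ) {D : Set V} {ω : JumpPath V} {n : ℕ}
    (hn : ∀ k < n, ω.state k ∉ D) (hnD : ω.state n ∈ D) (hpos : 0 < (ω (n + 1)).1) :
    stoppedGain r f (hitTime D) ω =
      discount r (ω.jumpTime n) * ENNReal.ofReal (f (ω.state n)) := by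
  by_cases hσ : ω.jumpTime n = ⊤
  · have htop : hitTime D ω = ⊤ := by
      by_contra h
      obtain ⟨T, hT⟩ := WithTop.ne_top_iff_exists.1 h
      exact absurd (jumpTime_le_hitTime hn hT.symm) (by simp [hσ])
    rw [stoppedGain, if_pos htop, hσ, discount_top, zero_mul]
  · obtain ⟨c, hc⟩ : ∃ c : ℝ≥0, (c : ℝ≥0∞) = ω.jumpTime n := ⟨_, ENNReal.coe_toNNReal hσ⟩
    have hlt : (c : ℝ≥0∞) < ω.jumpTime (n + 1) := by
      rw [jumpTime_succ, ← hc]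
      exact ENNReal.lt_add_right ENNReal.coe_ne_top hpos.ne'
    have hle : hitTime D ω ≤ c := hittingAfter_le_of_mem zero_le
      ⟨_, hnD, (process_eq_of_mem hc.ge hlt).symm⟩
    obtain ⟨T, hT⟩ := WithTop.ne_top_iff_exists.1 (ne_top_of_le_ne_top WithTop.coe_ne_top hle)
    have hTc : T = c := by
      refine le_antisymm (WithTop.coe_le_coe.1 (hT.trans_le hle)) ?_
      have := jumpTime_le_hitTime hn hT.symm
      rw [← hc] at this
      exact ENNReal.coe_le_coe.1 this
    rw [stoppedGain, ← hT, if_neg WithTop.coe_ne_top, WithTop.untopD_coe, hTc,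
      gain_of_mem hc.ge hlt, hc]

lemma stoppedGain_hitTime_le {r : ℝ} (hr : 0 ≤ r) {f : V → ℝ} {C : ℝ} (hC : ∀ x, f x ≤ C)
    {D : Set V} {ω : JumpPath V} {n : ℕ} (hn : ∀ k < n, ω.state k ∉ D) :
    stoppedGain r f (hitTime D) ω ≤ ENNReal.ofReal C * discount r (ω.jumpTime n) := by
  rw [stoppedGain]
  split_ifs with h
  · exact zero_le
  · obtain ⟨T, hT⟩ := WithTop.ne_top_iff_exists.1 h
    rw [← hT, WithTop.untopD_coe, gain, mul_comm]
    refine mul_le_mul' ?_ (discount_anti hr (jumpTime_le_hitTime hn hT.symm))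
    cases process T ω with
    | none => exact zero_le
    | some v => exact ENNReal.ofReal_le_ofReal (hC v)

open Classical in
/-- The value `e^{-rσ_k} g(X_{σ_k})` at the index `k = κ ∧ n`, where `κ` is the first index at which
the embedded chain is in `D`. -/
def hitStage (r : ℝ) (g : V → ℝ) (D : Set V) : ℕ → JumpPath V → ℝ≥0∞
  | 0, ω => discount r (ω.jumpTime 0) * ENNReal.ofReal (g (ω.state 0))
  | n + 1, ω =>
    if ∀ k ≤ n, ω.state k ∉ D then
      discount r (ω.jumpTime (n + 1)) * ENNReal.ofReal (g (ω.state (n + 1)))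
    else hitStage r g D n ω

lemma hitStage_of_notMem (r : ℝ) (g : V → ℝ) {D : Set V} {ω : JumpPath V} {n : ℕ}
    (hn : ∀ k < n, ω.state k ∉ D) :
    hitStage r g D n ω = discount r (ω.jumpTime n) * ENNReal.ofReal (g (ω.state n)) := by
  cases n with
  | zero => rfl
  | succ n => exact if_pos fun k hk => hn k (Nat.lt_succ_of_le hk)

lemma hitStage_of_mem (r : ℝ) (g : V → ℝ) {D : Set V} {ω : JumpPath V} {m n : ℕ}
    (hm : ∀ k < m, ω.state k ∉ D) (hmD : ω.state m ∈ D) (hmn : m ≤ n) :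
    hitStage r g D n ω = discount r (ω.jumpTime m) * ENNReal.ofReal (g (ω.state m)) := by
  induction n, hmn using Nat.le_induction with
  | base => exact hitStage_of_notMem r g hm
  | succ n hmn ih => rw [hitStage, if_neg fun h => h m hmn hmD, ih]

lemma hitStage_freeze (r : ℝ) (g : V → ℝ) (D : Set V) {m n : ℕ} (hmn : m ≤ n) (ω : JumpPath V) :
    hitStage r g D m (freeze n ω) = hitStage r g D m ω := by
  induction m with
  | zero => rw [hitStage, hitStage, jumpTime_freeze hmn, state_freeze hmn]
  | succ m ih =>
    have h : (∀ k ≤ m, (freeze n ω).state k ∉ D) ↔ ∀ k ≤ m, ω.state k ∉ D :=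
      forall₂_congr fun k hk => by rw [state_freeze (by omega)]
    rw [hitStage, hitStage, jumpTime_freeze hmn, state_freeze hmn, ih (by omega)]
    by_cases hc : ∀ k ≤ m, ω.state k ∉ D
    · rw [if_pos hc, if_pos (h.2 hc)]
    · rw [if_neg hc, if_neg (mt h.1 hc)]

variable [MeasurableSpace V] [DiscreteMeasurableSpace V]

lemma measurableSet_state_notMem (D : Set V) (n : ℕ) :
    MeasurableSet {ω : JumpPath V | ∀ k ≤ n, ω.state k ∉ D} := by
  have h : {ω : JumpPath V | ∀ k ≤ n, ω.state k ∉ D} =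
      ⋂ k, ⋂ _ : k ≤ n, (fun ω : JumpPath V => ω.state k) ⁻¹' Dᶜ := by
    ext ω
    simp
  rw [h]
  exact MeasurableSet.iInter fun k => MeasurableSet.iInter fun _ =>
    measurable_state k (MeasurableSet.of_discrete (s := Dᶜ))

lemma measurable_hitStage (r : ℝ) (g : V → ℝ) (D : Set V) (n : ℕ) :
    Measurable (hitStage r g D n) := by
  induction n with
  | zero => exact measurable_discount_mul_state r g 0
  | succ n ih =>
    exact Measurable.ite (measurableSet_state_notMem D n)
      (measurable_discount_mul_state r g (n + 1)) ih

end JumpPath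

namespace MarkovGenerator

open JumpPath

lemma exists_discount_bound {V : Type*} [Fintype V] [DecidableEq V] (L : MarkovGenerator V)
    {r : ℝ} (hr : 0 < r) :
    ∃ q < 1, ∀ x, ENNReal.ofReal (L.exitRate x / (L.exitRate x + r)) ≤ q := by
  refine ⟨Finset.univ.sup fun x => ENNReal.ofReal (L.exitRate x / (L.exitRate x + r)), ?_,
    fun x => Finset.le_sup (f := fun x => ENNReal.ofReal (L.exitRate x / (L.exitRate x + r)))
      (Finset.mem_univ x)⟩
  rw [Finset.sup_lt_iff (by simp)]
  intro x _
  have hx := L.exitRate_nonneg x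
  rw [ENNReal.ofReal_lt_one, div_lt_one (by positivity)]
  linarith

variable {V : Type*} [Fintype V] [DecidableEq V] [MeasurableSpace V] [DiscreteMeasurableSpace V]
  (L : MarkovGenerator V) {r : ℝ}

/-- If `g` is `r`-harmonic off `D`, then `e^{-rσ_n} g(X_{σ_n})`, stopped at the entrance of the
embedded chain in `D`, has a constant expectation. -/
lemma lintegral_hitStage (hr : 0 < r) {g : V → ℝ} (hg : ∀ x, 0 ≤ g x) {D : Set V}
    (hgD : ∀ x ∉ D, L.apply g x - r * g x = 0) (x : V) (n : ℕ) :
    ∫⁻ ω, hitStage r g D n ω ∂L.law x = ENNReal.ofReal (g x) := by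
  classical
  induction n with
  | zero =>
    calc ∫⁻ ω, hitStage r g D 0 ω ∂L.law x = ∫⁻ _, ENNReal.ofReal (g x) ∂L.law x := by
          refine lintegral_congr_ae ?_
          filter_upwards [L.law_zero x] with ω hω
          rw [hitStage, jumpTime_zero, discount_zero, one_mul, state, hω]
      _ = ENNReal.ofReal (g x) := by simp
  | succ n ih =>
    let G : JumpPath V → ℝ≥0∞ × V → ℝ≥0∞ := fun ω p =>
      if ∀ k ≤ n, ω.state k ∉ D then
        discount r (ω.jumpTime n) * (discount r p.1 * ENNReal.ofReal (g p.2))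
      else hitStage r g D n ω
    have hp : Measurable fun p : ℝ≥0∞ × V => discount r p.1 * ENNReal.ofReal (g p.2) :=
      (measurable_discount.comp measurable_fst).mul
        ((Measurable.of_discrete (f := fun v => ENNReal.ofReal (g v))).comp measurable_snd)
    have hG : Measurable (Function.uncurry G) :=
      Measurable.ite (measurable_fst (measurableSet_state_notMem D n))
        (((measurable_discount.comp (measurable_jumpTime n)).comp measurable_fst).mul
          (hp.comp measurable_snd)) ((measurable_hitStage r g D n).comp measurable_fst)
    rw [← ih]
    calc ∫⁻ ω, hitStage r g D (n + 1) ω ∂L.law x = ∫⁻ ω, G ω (ω (n + 1)) ∂L.law x := by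
          refine lintegral_congr fun ω => ?_
          rw [hitStage, jumpTime_succ, discount_add, mul_assoc]
          rfl
      _ = ∫⁻ ω, ∫⁻ p, G ω p ∂L.stepKernel (ω.state n) ∂L.law x := by
          refine L.lintegral_succ x n hG fun ω p => ?_
          have h : (∀ k ≤ n, (freeze n ω).state k ∉ D) ↔ ∀ k ≤ n, ω.state k ∉ D :=
            forall₂_congr fun k hk => by rw [state_freeze hk]
          simp only [G, h, jumpTime_freeze le_rfl, hitStage_freeze r g D le_rfl]
      _ = ∫⁻ ω, hitStage r g D n ω ∂L.law x := by
          refine lintegral_congr fun ω => ?_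
          by_cases h : ∀ k ≤ n, ω.state k ∉ D
          · simp only [G, if_pos h]
            rw [lintegral_const_mul _ hp, L.lintegral_step_discount_eq hr hg (hgD _ (h n le_rfl)),
              hitStage_of_notMem r g fun k hk => h k hk.le]
          · simp only [G, if_neg h, lintegral_const, measure_univ, mul_one]

lemma lintegral_discount_jumpTime_le (hr : 0 < r) {q : ℝ≥0∞}
    (hq : ∀ x, ENNReal.ofReal (L.exitRate x / (L.exitRate x + r)) ≤ q) (x : V) (n : ℕ) :
    ∫⁻ ω, discount r (ω.jumpTime n) ∂L.law x ≤ q ^ n := by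
  induction n with
  | zero => simp [jumpTime_zero]
  | succ n ih =>
    have hσ : Measurable fun ω : JumpPath V => discount r (ω.jumpTime n) :=
      measurable_discount.comp (measurable_jumpTime n)
    have hp : Measurable fun p : ℝ≥0∞ × V => discount r p.1 :=
      measurable_discount.comp measurable_fst
    calc ∫⁻ ω, discount r (ω.jumpTime (n + 1)) ∂L.law x
        = ∫⁻ ω, discount r (ω.jumpTime n) * discount r (ω (n + 1)).1 ∂L.law x := by
          simp only [jumpTime_succ, discount_add]
      _ = ∫⁻ ω, ∫⁻ p, discount r (ω.jumpTime n) * discount r p.1 ∂L.stepKernel (ω.state n)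
            ∂L.law x :=
          L.lintegral_succ x n (G := fun ω p => discount r (ω.jumpTime n) * discount r p.1)
            ((hσ.comp measurable_fst).mul (hp.comp measurable_snd))
            (fun ω p => by rw [jumpTime_freeze le_rfl])
      _ ≤ ∫⁻ ω, discount r (ω.jumpTime n) * q ∂L.law x := by
          refine lintegral_mono fun ω => ?_
          rw [lintegral_const_mul _ hp, L.lintegral_step_discount hr]
          gcongr
          exact hq _
      _ ≤ q ^ (n + 1) := by
          rw [lintegral_mul_const _ hσ, pow_succ]
          gcongr

/-- The expected reward of the first hitting time of `D` is the solution of the Dirichlet problem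
`g = φ` on `D`, `𝓛[g] = r g` off `D`. -/
lemma lintegral_stoppedGain_hitTime (hr : 0 < r) {φ g : V → ℝ} (hg : ∀ x, 0 ≤ g x) {D : Set V}
    (hgφ : ∀ x ∈ D, g x = φ x) (hgD : ∀ x ∉ D, L.apply g x - r * g x = 0) (x : V) :
    ∫⁻ ω, stoppedGain r φ (hitTime D) ω ∂L.law x = ENNReal.ofReal (g x) := by
  obtain ⟨q, hq1, hq⟩ := L.exists_discount_bound hr
  obtain ⟨C, hCφ, hCg⟩ : ∃ C : ℝ, (∀ x, φ x ≤ C) ∧ ∀ x, g x ≤ C := by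
    obtain ⟨a, ha⟩ := (Set.finite_range φ).bddAbove
    obtain ⟨b, hb⟩ := (Set.finite_range g).bddAbove
    exact ⟨max a b, fun x => (ha ⟨x, rfl⟩).trans (le_max_left _ _),
      fun x => (hb ⟨x, rfl⟩).trans (le_max_right _ _)⟩
  have hσ : ∀ n, Measurable fun ω : JumpPath V =>
      ENNReal.ofReal C * discount r (ω.jumpTime n) := fun n =>
    (measurable_discount.comp (measurable_jumpTime n)).const_mul _
  have herr : ∀ n, ∫⁻ ω, ENNReal.ofReal C * discount r (ω.jumpTime n) ∂L.law x ≤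
      ENNReal.ofReal C * q ^ n := by
    intro n
    rw [lintegral_const_mul _ (by exact measurable_discount.comp (measurable_jumpTime n))]
    gcongr
    exact L.lintegral_discount_jumpTime_le hr hq x n
  have hlim : ∀ a : ℝ≥0∞, Tendsto (fun n : ℕ => a + ENNReal.ofReal C * q ^ n) atTop (𝓝 a) := by
    intro a
    have h := ENNReal.Tendsto.const_mul (a := ENNReal.ofReal C)
      (ENNReal.tendsto_pow_atTop_nhds_zero_of_lt_one hq1) (Or.inr ENNReal.ofReal_ne_top)
    simpa using h.const_add a
  -- once the embedded chain has met `D`, the two rewards agree; before, both are `O(e^{-rσ_n})`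
  have hcases : ∀ n, ∀ᵐ ω ∂L.law x,
      stoppedGain r φ (hitTime D) ω = hitStage r g D n ω ∨ ∀ k < n, ω.state k ∉ D := by
    intro n
    filter_upwards [L.law_ae_pos x] with ω hpos
    by_cases h : ∀ k < n, ω.state k ∉ D
    · exact Or.inr h
    · left
      push Not at h
      classical
      have hex : ∃ k, ω.state k ∈ D := by
        obtain ⟨k, -, hk⟩ := h
        exact ⟨k, hk⟩
      have hmin : ∀ k < Nat.find hex, ω.state k ∉ D := fun k hk => Nat.find_min hex hk
      have hle : Nat.find hex ≤ n := by
        obtain ⟨k, hkn, hk⟩ := h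
        exact (Nat.find_min' hex hk).trans hkn.le
      rw [stoppedGain_hitTime_of_mem r φ hmin (Nat.find_spec hex) (hpos _),
        hitStage_of_mem r g hmin (Nat.find_spec hex) hle, hgφ _ (Nat.find_spec hex)]
  refine le_antisymm (ge_of_tendsto' (hlim _) fun n => ?_) (ge_of_tendsto' (hlim _) fun n => ?_)
  · calc ∫⁻ ω, stoppedGain r φ (hitTime D) ω ∂L.law x
        ≤ ∫⁻ ω, (hitStage r g D n ω + ENNReal.ofReal C * discount r (ω.jumpTime n))
            ∂L.law x := by
          refine lintegral_mono_ae ?_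
          filter_upwards [hcases n] with ω hω
          rcases hω with h | h
          · exact h.le.trans le_self_add
          · exact (stoppedGain_hitTime_le hr.le hCφ h).trans le_add_self
      _ ≤ ENNReal.ofReal (g x) + ENNReal.ofReal C * q ^ n := by
          rw [lintegral_add_right _ (hσ n), L.lintegral_hitStage hr hg hgD]
          gcongr
          exact herr n
  · calc ENNReal.ofReal (g x) = ∫⁻ ω, hitStage r g D n ω ∂L.law x :=
          (L.lintegral_hitStage hr hg hgD x n).symm
      _ ≤ ∫⁻ ω, (stoppedGain r φ (hitTime D) ω + ENNReal.ofReal C * discount r (ω.jumpTime n))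
            ∂L.law x := by
          refine lintegral_mono_ae ?_
          filter_upwards [hcases n] with ω hω
          rcases hω with h | h
          · exact h.ge.trans le_self_add
          · rw [hitStage_of_notMem r g h, mul_comm]
            refine le_trans ?_ le_add_self
            gcongr
            exact hCg _
      _ ≤ ∫⁻ ω, stoppedGain r φ (hitTime D) ω ∂L.law x + ENNReal.ofReal C * q ^ n := by
          rw [lintegral_add_right _ (hσ n)]
          gcongr
          exact herr n

end MarkovGenerator

/-! ### The minimum principle -/

namespace MarkovGenerator

open JumpPath

section minimum

variable {V : Type*} [Fintype V] [DecidableEq V] (L : MarkovGenerator V)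

lemma apply_eq_sum_sub (g : V → ℝ) (x : V) :
    L.apply g x = ∑ y ∈ Finset.univ.erase x, L.rate x y * (g y - g x) := by
  rw [apply, ← Finset.add_sum_erase _ _ (Finset.mem_univ x), L.rate_diag]
  simp only [mul_sub, Finset.sum_sub_distrib, ← Finset.sum_mul]
  ring

lemma apply_nonneg_of_isMin {g : V → ℝ} {x : V} (h : ∀ y, g x ≤ g y) : 0 ≤ L.apply g x := by
  rw [apply_eq_sum_sub]
  exact Finset.sum_nonneg fun y hy => mul_nonneg
    (L.rate_nonneg x y (Finset.ne_of_mem_erase hy).symm) (sub_nonneg.2 (h y))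

lemma apply_sub (f g : V → ℝ) (x : V) :
    L.apply (fun y => f y - g y) x = L.apply f x - L.apply g x := by
  simp only [apply, mul_sub, Finset.sum_sub_distrib]

lemma apply_const (c : ℝ) (x : V) : L.apply (fun _ => c) x = 0 := by
  simp [apply_eq_sum_sub]

/-- The minimum principle. -/
lemma nonneg_of_apply_le {r : ℝ} (hr : 0 < r) {g : V → ℝ}
    (h : ∀ x, g x < 0 → L.apply g x - r * g x ≤ 0) (x : V) : 0 ≤ g x := by
  have : Nonempty V := ⟨x⟩
  obtain ⟨x₀, hx₀⟩ := Finite.exists_min g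
  by_contra! hx
  have h0 : g x₀ < 0 := (hx₀ x).trans_lt hx
  have h1 := L.apply_nonneg_of_isMin hx₀
  have h2 := h x₀ h0
  have h3 := mul_neg_of_pos_of_neg hr h0
  linarith

lemma pos_of_apply_lt {r : ℝ} {g : V → ℝ} (hg : ∀ x, 0 ≤ g x) {x : V}
    (h : L.apply g x - r * g x < 0) : 0 < g x := by
  refine lt_of_le_of_ne (hg x) fun h0 => ?_
  have h1 := L.apply_nonneg_of_isMin (g := g) (x := x) fun y => h0.symm.trans_le (hg y)
  rw [← h0, mul_zero, sub_zero] at h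
  linarith

/-- The Dirichlet problem is solvable: by the minimum principle, the corresponding endomorphism of
`V → ℝ` is injective, hence surjective. -/
lemma exists_dirichlet {r : ℝ} (hr : 0 < r) (φ : V → ℝ) (D : Set V) :
    ∃ g : V → ℝ, (∀ x ∈ D, g x = φ x) ∧ ∀ x ∉ D, L.apply g x - r * g x = 0 := by
  classical
  let Φ : (V → ℝ) →ₗ[ℝ] (V → ℝ) :=
    { toFun := fun g x => if x ∈ D then g x else L.apply g x - r * g x
      map_add' := fun f g => by
        funext x
        by_cases hx : x ∈ D
        · simp [hx]
        · simp only [hx, if_false, Pi.add_apply, apply, mul_add, Finset.sum_add_distrib]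
          ring
      map_smul' := fun c g => by
        funext x
        by_cases hx : x ∈ D
        · simp [hx]
        · simp only [hx, if_false, Pi.smul_apply, apply, smul_eq_mul, RingHom.id_apply, mul_sub,
            Finset.mul_sum]
          congr 1
          · exact Finset.sum_congr rfl fun y _ => by ring
          · ring }
  have hnn : ∀ g, Φ g = 0 → ∀ x, 0 ≤ g x := by
    intro g hg
    refine L.nonneg_of_apply_le hr fun x hx => ?_
    have hgx : (if x ∈ D then g x else L.apply g x - r * g x) = 0 := congrFun hg x
    split_ifs at hgx with h
    · exact absurd hgx hx.ne
    · exact hgx.le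
  have hinj : Function.Injective Φ := by
    rw [← LinearMap.ker_eq_bot, LinearMap.ker_eq_bot']
    intro g hg
    funext x
    refine le_antisymm ?_ (hnn g hg x)
    have := hnn (-g) (by rw [map_neg, hg, neg_zero]) x
    simpa using this
  obtain ⟨g, hg⟩ := LinearMap.injective_iff_surjective.1 hinj fun x => if x ∈ D then φ x else 0
  have hgx : ∀ x, (if x ∈ D then g x else L.apply g x - r * g x) = if x ∈ D then φ x else 0 :=
    congrFun hg
  refine ⟨g, fun x hx => ?_, fun x hx => ?_⟩
  · simpa only [if_pos hx] using hgx x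
  · simpa only [if_neg hx] using hgx x

end minimum

variable {V : Type*} [Fintype V] [DecidableEq V] [MeasurableSpace V] [DiscreteMeasurableSpace V]
  (L : MarkovGenerator V) {r : ℝ} {φ : V → ℝ}

/-! ### Expected payoffs -/

lemma aestronglyMeasurable_payoff {x : V} {τ : JumpPath V → WithTop ℝ≥0}
    (hτ : IsStopping (L.law x) τ) (hφ : ∀ x, 0 ≤ φ x) :
    AEStronglyMeasurable (payoff r φ τ) (L.law x) := by
  have h : payoff r φ τ = fun ω => (stoppedGain r φ τ ω).toReal := by
    funext ω
    rw [← ofReal_payoff, ENNReal.toReal_ofReal (payoff_nonneg hφ τ ω)]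
  rw [h]
  exact (L.aemeasurable_stoppedGain hτ r φ).ennreal_toReal.aestronglyMeasurable

lemma integrable_payoff (hr : 0 ≤ r) (hφ : ∀ x, 0 ≤ φ x) {x : V} {τ : JumpPath V → WithTop ℝ≥0}
    (hτ : IsStopping (L.law x) τ) : Integrable (payoff r φ τ) (L.law x) := by
  obtain ⟨C, hC⟩ := (Set.finite_range φ).bddAbove
  have hC' : ∀ y, φ y ≤ C := fun y => hC ⟨y, rfl⟩
  refine Integrable.of_bound (L.aestronglyMeasurable_payoff hτ hφ) C (ae_of_all _ fun ω => ?_)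
  rw [Real.norm_of_nonneg (payoff_nonneg hφ τ ω)]
  exact (payoff_mono hC' τ ω).trans (payoff_const_le hr ((hφ x).trans (hC' x)) τ ω)

lemma reward_eq_toReal (hφ : ∀ x, 0 ≤ φ x) {x : V} {τ : JumpPath V → WithTop ℝ≥0}
    (hτ : IsStopping (L.law x) τ) :
    L.reward r φ τ x = (∫⁻ ω, stoppedGain r φ τ ω ∂L.law x).toReal := by
  rw [reward, integral_eq_lintegral_of_nonneg_ae (ae_of_all _ (payoff_nonneg hφ τ))
    (L.aestronglyMeasurable_payoff hτ hφ)]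
  simp only [ofReal_payoff]

/-- The verification principle. -/
lemma reward_le (hr : 0 < r) (hφ : ∀ x, 0 ≤ φ x) {f : V → ℝ} (hφf : ∀ x, φ x ≤ f x)
    (hLf : ∀ x, L.apply f x - r * f x ≤ 0) {x : V} {τ : JumpPath V → WithTop ℝ≥0}
    (hτ : IsStopping (L.law x) τ) : L.reward r φ τ x ≤ f x := by
  have hf : ∀ x, 0 ≤ f x := fun x => (hφ x).trans (hφf x)
  rw [L.reward_eq_toReal hφ hτ]
  refine ENNReal.toReal_le_of_le_ofReal (hf x) (le_trans (lintegral_mono fun ω => ?_)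
    (L.lintegral_stoppedGain_le hτ hr hf hLf))
  rw [← ofReal_payoff, ← ofReal_payoff]
  exact ENNReal.ofReal_le_ofReal (payoff_mono hφf τ ω)

lemma reward_hitTime_spec (hr : 0 < r) (hφ : ∀ x, 0 ≤ φ x) (D : Set V) :
    (∀ x, 0 ≤ L.reward r φ (hitTime D) x) ∧
    (∀ x ∈ D, L.reward r φ (hitTime D) x = φ x) ∧
    ∀ x ∉ D, L.apply (L.reward r φ (hitTime D)) x - r * L.reward r φ (hitTime D) x = 0 := by
  obtain ⟨g, hgφ, hgD⟩ := L.exists_dirichlet hr φ D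
  have hg : ∀ x, 0 ≤ g x := by
    refine L.nonneg_of_apply_le hr fun x hx => ?_
    by_cases h : x ∈ D
    · rw [hgφ x h] at hx
      exact absurd (hφ x) (not_le.2 hx)
    · exact (hgD x h).le
  have hfun : L.reward r φ (hitTime D) = g := by
    funext x
    rw [L.reward_eq_toReal hφ (isStopping_hitTime D),
      L.lintegral_stoppedGain_hitTime hr hg hgφ hgD, ENNReal.toReal_ofReal (hg x)]
  rw [hfun]
  exact ⟨hg, hgφ, hgD⟩

/-- Removing from `D` the points where `𝓛[w] > r w`, with `w` the expected reward of hitting `D`,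
increases the expected reward, strictly at the removed points. -/
lemma reward_hitTime_improve (hr : 0 < r) (hφ : ∀ x, 0 ≤ φ x) {D D' : Set V}
    (hD' : D' = {x ∈ D | L.apply (L.reward r φ (hitTime D)) x -
      r * L.reward r φ (hitTime D) x ≤ 0}) :
    (∀ x, L.reward r φ (hitTime D) x ≤ L.reward r φ (hitTime D') x) ∧
    ∀ x ∈ D, x ∉ D' → L.reward r φ (hitTime D) x < L.reward r φ (hitTime D') x := by
  obtain ⟨-, h1, h2⟩ := L.reward_hitTime_spec hr hφ D
  obtain ⟨-, h1', h2'⟩ := L.reward_hitTime_spec hr hφ D'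
  set w := L.reward r φ (hitTime D)
  set w' := L.reward r φ (hitTime D')
  have hmem : ∀ x, x ∈ D' ↔ x ∈ D ∧ L.apply w x - r * w x ≤ 0 := fun x => by rw [hD']; rfl
  have hlt : ∀ x ∈ D, x ∉ D' → L.apply (fun y => w' y - w y) x - r * (w' x - w x) < 0 := by
    intro x hx hx'
    rw [apply_sub]
    have h3 := h2' x hx'
    have h4 : ¬ L.apply w x - r * w x ≤ 0 := fun h => hx' ((hmem x).2 ⟨hx, h⟩)
    linarith
  have hnn : ∀ x, 0 ≤ w' x - w x := by
    refine L.nonneg_of_apply_le hr fun x hx => ?_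
    by_cases hxD' : x ∈ D'
    · rw [h1' x hxD', h1 x ((hmem x).1 hxD').1, sub_self] at hx
      exact absurd hx (lt_irrefl 0)
    by_cases hxD : x ∈ D
    · exact (hlt x hxD hxD').le
    · rw [apply_sub]
      have h3 := h2' x hxD'
      have h4 := h2 x hxD
      linarith
  exact ⟨fun x => sub_nonneg.1 (hnn x), fun x hx hx' =>
    sub_pos.1 (L.pos_of_apply_lt hnn (hlt x hx hx'))⟩

lemma reward_hitTime_le (hr : 0 < r) (hφ : ∀ x, 0 ≤ φ x) {M : ℝ} (hM : ∀ x, φ x ≤ M)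
    (D : Set V) (x : V) : L.reward r φ (hitTime D) x ≤ M :=
  L.reward_le hr hφ (f := fun _ => M) hM (fun y => by
    rw [apply_const]
    have := mul_nonneg hr.le ((hφ y).trans (hM y))
    linarith) (isStopping_hitTime D)

/-! ### The recursion -/

/-- As `stopSet` is the whole space at the index `0`, where `u_0 = φ`, the first step of the
recursion is not an exception. -/
lemma stopSet_succ (hr : 0 < r) (hφ : ∀ x, 0 ≤ φ x) (n : ℕ) :
    L.stopSet r φ (n + 1) = {x ∈ L.stopSet r φ n |
      L.apply (L.stopValue r φ n) x - r * L.stopValue r φ n x ≤ 0} := by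
  cases n with
  | zero =>
    have h : L.stopValue r φ 0 = φ :=
      funext fun x => (L.reward_hitTime_spec hr hφ _).2.1 x (Set.mem_univ x)
    rw [h]
    simp [stopSet]
  | succ n => rfl

lemma stopSet_antitone (hr : 0 < r) (hφ : ∀ x, 0 ≤ φ x) : Antitone (L.stopSet r φ) :=
  antitone_nat_of_succ_le fun n => by
    rw [L.stopSet_succ hr hφ]
    exact fun x hx => hx.1

lemma stopValue_le_succ (hr : 0 < r) (hφ : ∀ x, 0 ≤ φ x) (n : ℕ) (x : V) :
    L.stopValue r φ n x ≤ L.stopValue r φ (n + 1) x :=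
  (L.reward_hitTime_improve hr hφ (L.stopSet_succ hr hφ n)).1 x

lemma lt_stopValue_of_notMem (hr : 0 < r) (hφ : ∀ x, 0 ≤ φ x) (n : ℕ) {x : V}
    (hx : x ∉ L.stopSet r φ n) : φ x < L.stopValue r φ n x := by
  induction n with
  | zero => exact absurd (Set.mem_univ x) hx
  | succ n ih =>
    by_cases h : x ∈ L.stopSet r φ n
    · rw [← (L.reward_hitTime_spec hr hφ (L.stopSet r φ n)).2.1 x h]
      exact (L.reward_hitTime_improve hr hφ (L.stopSet_succ hr hφ n)).2 x h hx
    · exact (ih h).trans_le (L.stopValue_le_succ hr hφ n x)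

lemma stopValue_of_mem (hr : 0 < r) (hφ : ∀ x, 0 ≤ φ x) (n : ℕ) {x : V}
    (hx : x ∈ L.stopSet r φ n) : L.stopValue r φ n x = φ x :=
  (L.reward_hitTime_spec hr hφ _).2.1 x hx

/-- The sets `D_n` contain the maximum points of `φ`. -/
lemma mem_stopSet_of_isMax (hr : 0 < r) (hφ : ∀ x, 0 ≤ φ x) {x : V} (hx : ∀ y, φ y ≤ φ x)
    (n : ℕ) : x ∈ L.stopSet r φ n := by
  induction n with
  | zero => exact Set.mem_univ x
  | succ n ih =>
    rw [L.stopSet_succ hr hφ]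
    refine ⟨ih, ?_⟩
    have hv := L.stopValue_of_mem hr hφ n ih
    have h := L.apply_nonneg_of_isMin (g := fun y => φ x - L.stopValue r φ n y) (x := x) fun y => by
      rw [hv, sub_self, sub_nonneg]
      exact L.reward_hitTime_le hr hφ hx _ y
    rw [L.apply_sub (fun _ => φ x), apply_const] at h
    rw [hv]
    have := mul_nonneg hr.le (hφ x)
    linarith

/-- When the recursion is stationary at `n`, the function `u_n` is `r`-excessive and dominates `φ`,
so it is the value function. -/
lemma value_eq_stopValue (hr : 0 < r) (hφ : ∀ x, 0 ≤ φ x) {n : ℕ}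
    (hn : L.stopSet r φ (n + 1) = L.stopSet r φ n) : L.value r φ = L.stopValue r φ n := by
  have hle : ∀ x, φ x ≤ L.stopValue r φ n x := fun x => by
    by_cases hx : x ∈ L.stopSet r φ n
    · exact (L.stopValue_of_mem hr hφ n hx).ge
    · exact (L.lt_stopValue_of_notMem hr hφ n hx).le
  have hL : ∀ x, L.apply (L.stopValue r φ n) x - r * L.stopValue r φ n x ≤ 0 := fun x => by
    by_cases hx : x ∈ L.stopSet r φ n
    · rw [← hn, L.stopSet_succ hr hφ] at hx
      exact hx.2
    · exact ((L.reward_hitTime_spec hr hφ _).2.2 x hx).le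
  funext x
  refine IsGreatest.csSup_eq ⟨⟨_, isStopping_hitTime _, rfl⟩, ?_⟩
  rintro _ ⟨τ, hτ, rfl⟩
  exact L.reward_le hr hφ hle hL hτ

lemma stopSet_eq_stoppingRegion (hr : 0 < r) (hφ : ∀ x, 0 ≤ φ x) {n : ℕ}
    (hn : L.stopSet r φ (n + 1) = L.stopSet r φ n) :
    L.stopSet r φ n = L.stoppingRegion r φ := by
  ext x
  rw [stoppingRegion, Set.mem_ofPred_eq, L.value_eq_stopValue hr hφ hn]
  refine ⟨L.stopValue_of_mem hr hφ n, fun h => ?_⟩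
  by_contra hx
  exact (L.lt_stopValue_of_notMem hr hφ n hx).ne' h

lemma stopSet_stationary (hr : 0 < r) (hφ : ∀ x, 0 ≤ φ x) {n : ℕ}
    (hn : L.stopSet r φ (n + 1) = L.stopSet r φ n) {m : ℕ} (hnm : n ≤ m) :
    L.stopSet r φ m = L.stopSet r φ n := by
  induction m, hnm using Nat.le_induction with
  | base => rfl
  | succ m _ ih =>
    rw [L.stopSet_succ hr hφ, stopValue, ih, ← hn]
    conv_rhs => rw [L.stopSet_succ hr hφ, stopValue]
    rw [hn]

/-- As `D_1 ⊇ D_2 ⊇ ⋯` are nonempty, there is room for at most `card V - 1` strict inclusions. -/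
lemma exists_stopSet_succ_eq [Nonempty V] (hr : 0 < r) (hφ : ∀ x, 0 ≤ φ x) :
    ∃ n, 1 ≤ n ∧ n ≤ Fintype.card V ∧ L.stopSet r φ (n + 1) = L.stopSet r φ n := by
  by_contra! h
  have hcard : ∀ n ≤ Fintype.card V, (L.stopSet r φ (n + 1)).ncard + n ≤ Fintype.card V := by
    intro n
    induction n with
    | zero =>
      intro _
      rw [add_zero, ← Nat.card_eq_fintype_card]
      exact Set.ncard_le_card _
    | succ n ih =>
      intro hn
      have hss : L.stopSet r φ (n + 1 + 1) ⊂ L.stopSet r φ (n + 1) :=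
        lt_of_le_of_ne (L.stopSet_antitone hr hφ (Nat.le_succ _)) (h (n + 1) (by omega) hn)
      have := Set.ncard_lt_ncard hss (Set.toFinite _)
      have := ih (by omega)
      omega
  obtain ⟨x, hx⟩ := Finite.exists_max φ
  have h1 := hcard _ le_rfl
  have h2 : 0 < (L.stopSet r φ (Fintype.card V + 1)).ncard :=
    (Set.ncard_pos (Set.toFinite _)).2 ⟨x, L.mem_stopSet_of_isMax hr hφ hx _⟩
  omega

end MarkovGenerator

end

theorem mainTheorem2 {V : Type*} [Fintype V] [DecidableEq V] [Nonempty V]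
    [MeasurableSpace V] [DiscreteMeasurableSpace V]
    (L : MarkovGenerator V) (r : ℝ) (hr : 0 < r) (φ : V → ℝ) (hφ : ∀ x, 0 ≤ φ x) :
    -- the optimal stopping problem is well posed, and the `τ_n` are stopping times
    (∀ x τ, JumpPath.IsStopping (L.law x) τ → Integrable (JumpPath.payoff r φ τ) (L.law x)) ∧
    (∀ x, BddAbove (L.rewards r φ x)) ∧
    (∀ x, ∀ n ≥ 1, JumpPath.IsStopping (L.law x) (JumpPath.hitTime (L.stopSet r φ n))) ∧
    -- `u_n` increases to `u`
    (∀ n ≥ 1, ∀ x, L.stopValue r φ n x ≤ L.stopValue r φ (n + 1) x) ∧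
    (∀ x, Tendsto (fun n => L.stopValue r φ n x) atTop (𝓝 (L.value r φ x))) ∧
    -- the intersection of the `D_n` is the stopping region
    (⋂ n ≥ 1, L.stopSet r φ n) = L.stoppingRegion r φ ∧
    -- the procedure stops after at most `card V` steps
    (∃ n₀, 1 ≤ n₀ ∧ n₀ ≤ Fintype.card V ∧ ∀ n ≥ n₀,
      L.stopValue r φ n = L.value r φ ∧ L.stopSet r φ n = L.stoppingRegion r φ) := by
  obtain ⟨n₀, h1, h2, hn₀⟩ := L.exists_stopSet_succ_eq hr hφ
  have hset : ∀ n ≥ n₀, L.stopSet r φ n = L.stoppingRegion r φ := fun n hn =>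
    (L.stopSet_stationary hr hφ hn₀ hn).trans (L.stopSet_eq_stoppingRegion hr hφ hn₀)
  have hval : ∀ n ≥ n₀, L.stopValue r φ n = L.value r φ := fun n hn =>
    (L.value_eq_stopValue hr hφ ((hset (n + 1) (by omega)).trans (hset n hn).symm)).symm
  refine ⟨fun x τ hτ => L.integrable_payoff hr.le hφ hτ, fun x => ?_,
    fun x n _ => JumpPath.isStopping_hitTime _, fun n _ x => L.stopValue_le_succ hr hφ n x,
    fun x => ?_, ?_, n₀, h1, h2, fun n hn => ⟨hval n hn, hset n hn⟩⟩
  · obtain ⟨y, hy⟩ := Finite.exists_max φ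
    refine ⟨φ y, ?_⟩
    rintro _ ⟨τ, hτ, rfl⟩
    refine L.reward_le hr hφ (f := fun _ => φ y) hy (fun z => ?_) hτ
    rw [MarkovGenerator.apply_const]
    have := mul_nonneg hr.le (hφ y)
    linarith
  · refine tendsto_const_nhds.congr' ?_
    filter_upwards [eventually_ge_atTop n₀] with n hn
    rw [hval n hn]
  · refine Set.Subset.antisymm (fun x hx => ?_) (Set.subset_iInter₂ fun n _ => ?_)
    · rw [← hset n₀ le_rfl]
      exact Set.mem_iInter₂.1 hx n₀ h1
    · rw [← hset (max n n₀) (le_max_right _ _)]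
      exact L.stopSet_antitone hr hφ (le_max_left _ _)
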